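/- Theorem (Convergence of SOBA, fixed step size). \textbf{Problem.} Let $F_1,\dots,F_m,\,G_1,\dots,G_n:\mathbb{R}^p\times\mathbb{R}^d\to\mathbb{R}$, where each $F_j$ is differentiable and each $G_i$ is twice differentiable. Put $F=\frac1m\sum_{j=1}^m F_j$ and $G=\frac1n\sum_{i=1}^n G_i$. Let $z^*(x)=\arg\min_{z} G(z,x)$, $v^*(x)=-[\nabla^2_{11}G(z^*(x),x)]^{-1}\nabla_1F(z^*(x),x)$ and $h(x)=F(z^*(x),x)$. Put $D_z(z,v,x)=\nabla_1G(z,x)$, $D_v(z,v,x)=\nabla^2_{11}G(z,x)v+\nabla_1F(z,x)$ and $D_x(z,v,x)=\nabla^2_{21}G(z,x)v+\nabla_2F(z,x)$. \textbf{Algorithm (SOBA).} Start at $(z^0,v^0,x^0)$. At iteration $t\ge 0$ draw indices $i\in\{1,\dots,n\}$ and $j\in\{1,\dots,m\}$ uniformly, independently of each other and of the previous iterations, and set $$D_z^t=\nabla_1G_i(z^t,x^t),\quad D_v^t=\nabla^2_{11}G_i(z^t,x^t)v^t+\nabla_1F_j(z^t,x^t),\quad D_x^t=\nabla^2_{21}G_i(z^t,x^t)v^t+\nabla_2F_j(z^t,x^t),$$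 $$z^{t+1}=z^t-\rho D_z^t,\qquad v^{t+1}=v^t-\rho D_v^t,\qquad x^{t+1}=x^t-\gamma D_x^t .$$ \textbf{Regularity assumptions.} Let $\mu_G,L_1^F,L_2^F,L_1^G,L_2^G,L_3^G,C_F>0$. The function $F$ is twice differentiable, and $\nabla F$, $\nabla^2F$ are Lipschitz in $(z,x)$ with constants $L_1^F$, $L_2^F$. The function $G$ is three times continuously differentiable, $G(\cdot,x)$ is $\mu_G$-strongly convex for every $x$, and $\nabla G,\nabla^2G,\nabla^3G$ are Lipschitz in $(z,x)$ with constants $L_1^G,L_2^G,L_3^G$. For every $x$, $\|\nabla_1F(z^*(x),x)\|\le C_F$. Moreover $h$ is bounded below. \textbf{Bounded-variance assumptions.} Let $B_z,B_v,B_x>0$. For all $0\le t<T$, almost surely, $$\mathbb{E}_t\|D_z^t\|^2\le B_z^2\big(1+\|D_z(z^t,v^t,x^t)\|^2\big),\quad \mathbb{E}_t\|D_v^t\|^2\le B_v^2\big(1+\|D_v(z^t,v^t,x^t)\|^2\big),\quad \mathbb{E}_t\|D_x^t\|^2\le B_x^2,$$ where $\mathbb{E}_t$ is the expectation conditional on $(z^t,v^t,x^t)$.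 \textbf{Constants.} Let $\omega=L_1^F+\frac{L_2^GC_F}{\mu_G}$, $L_z=L_1^G$, $L_v=L_x=\sqrt2\max(\omega,L_1^G)$, $$L_*=\max\Big(\tfrac{L_1^G}{\mu_G},\ \tfrac{C_FL_2^G}{\mu_G^2}\big(1+\tfrac{L_1^G}{\mu_G}\big)+\tfrac{L_1^F}{\mu_G}\big(1+\tfrac{L_1^G}{\mu_G}\big)\Big),\qquad L_{zx}=\tfrac{L_2^G(1+L_*)}{\mu_G}+\tfrac{L_1^GL_2^G(1+L_*)}{\mu_G^2},$$ $$L_{vx}=\tfrac{L_2^FL_*(1+L_*)+L_{zx}L_1^F+L_2^F(1+L_*)}{\mu_G}+\tfrac{2(L_2^G+L_1^F)(1+L_*)}{\mu_G^2}+\tfrac{C_FL_3^G(1+L_*)}{\mu_G^2}+\tfrac{4C_FL_2^G(1+L_*)}{\mu_G^3},$$ $\beta_{vz}=\frac{\omega^2}{2\mu_G}$, $\overline\beta_{zx}=\frac{8L_*^2}{\mu_G}$, $\overline\beta_{vx}=\frac{16L_*^2}{\mu_G}$, $\phi_z'=\frac1{8\overline\beta_{zx}}$, $\phi_v'=\min\big(\frac1{8\overline\beta_{vx}},\frac{\mu_G\phi_z'}{32\beta_{vz}}\big)$,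 and $$\overline\rho=\min\Big(\tfrac{16}{\mu_G},\tfrac{\mu_G}{16L_z^2B_z^2},\tfrac{\mu_G}{32L_v^2B_v^2},\tfrac{\beta_{vz}}{L_v^2B_v^2}\Big),\qquad \xi^2=\tfrac{\mu_G}4\min\Big[\min\big(\tfrac1{L_{zx}^2},\tfrac1{L_{vx}^2}\big)\tfrac{L_*^2}{B_x^2\overline\rho},\ \min(\phi_v',\phi_z')\tfrac1{2L_x^2}\Big],\quad \xi>0.$$ \textbf{Conclusion.} The function $h$ is differentiable. There is a constant $C$, depending only on $\mu_G,L_1^F,L_2^F,L_1^G,L_2^G,L_3^G,C_F,B_z,B_v,B_x$ and on an upper bound $\Delta$ of $h(x^0)-\inf h+\|z^0-z^*(x^0)\|^2+\|v^0-v^*(x^0)\|^2$ (in particular not on $T$, $n$, $m$, $p$, $d$), such that for every integer $T>1$, SOBA with the fixed steps $\rho=\overline\rho/\sqrt T$ and $\gamma=\xi\rho$ satisfies $$\frac1T\sum_{t=1}^T\mathbb{E}\big[\|\nabla h(x^t)\|^2\big]\le C\,T^{-1/2}.$$ -/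

import Mathlib

open MeasureTheory ProbabilityTheory

namespace SOBA

/-- `ℝ^k` with its Euclidean norm. -/
abbrev E (k : ℕ) : Type := EuclideanSpace ℝ (Fin k)

noncomputable section

/-! ### Derivatives of functions of two variables -/

/-- `f` as a function on `ℝ^p × ℝ^d`, where the product carries the Euclidean norm. -/
def joint {p d : ℕ} (f : E p → E d → ℝ) (y : WithLp 2 (E p × E d)) : ℝ := f y.fst y.snd

/-- `∇₁ f(z, x)`. -/
def grad1 {p d : ℕ} (f : E p → E d → ℝ) (z : E p) (x : E d) : E p :=
  gradient (fun z' => f z' x) z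

/-- `∇₂ f(z, x)`. -/
def grad2 {p d : ℕ} (f : E p → E d → ℝ) (z : E p) (x : E d) : E d :=
  gradient (fun x' => f z x') x

/-- `∇²₁₁ f(z, x)`, as a linear map on `ℝ^p`. -/
def hess11 {p d : ℕ} (f : E p → E d → ℝ) (z : E p) (x : E d) : E p →L[ℝ] E p :=
  fderiv ℝ (fun z' => grad1 f z' x) z

/-- `∇²₂₁ f(z, x)`, as a linear map from `ℝ^p` to `ℝ^d`: the `z`-derivative of `∇₂ f`. -/
def hess21 {p d : ℕ} (f : E p → E d → ℝ) (z : E p) (x : E d) : E p →L[ℝ] E d :=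
  fderiv ℝ (fun z' => grad2 f z' x) z

/-! ### The bilevel problem -/

/-- The empirical mean of a finite family of functions. -/
def mean {k p d : ℕ} (f : Fin k → E p → E d → ℝ) (z : E p) (x : E d) : ℝ :=
  (k : ℝ)⁻¹ * ∑ i, f i z x

/-- `z^*(x)`, a minimizer of `G(·, x)`. -/
def zStar {p d : ℕ} (G : E p → E d → ℝ) (x : E d) : E p :=
  Classical.epsilon fun z => IsMinOn (fun z' => G z' x) Set.univ z

/-- `v^*(x) = -[∇²₁₁ G(z^*(x), x)]⁻¹ ∇₁ F(z^*(x), x)`. -/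
def vStar {p d : ℕ} (F G : E p → E d → ℝ) (x : E d) : E p :=
  -(hess11 G (zStar G x) x).inverse (grad1 F (zStar G x) x)

/-- The value function `h(x) = F(z^*(x), x)`. -/
def value {p d : ℕ} (F G : E p → E d → ℝ) (x : E d) : ℝ := F (zStar G x) x

/-! ### Directions; the point is `y = (z, v, x)` -/

/-- `D_z(z, v, x) = ∇₁ G(z, x)`. -/
def dirZ {p d : ℕ} (G : E p → E d → ℝ) (y : E p × E p × E d) : E p :=
  grad1 G y.1 y.2.2

/-- `D_v(z, v, x) = ∇²₁₁ G(z, x) v + ∇₁ F(z, x)`. -/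
def dirV {p d : ℕ} (F G : E p → E d → ℝ) (y : E p × E p × E d) : E p :=
  hess11 G y.1 y.2.2 y.2.1 + grad1 F y.1 y.2.2

/-- `D_x(z, v, x) = ∇²₂₁ G(z, x) v + ∇₂ F(z, x)`. -/
def dirX {p d : ℕ} (F G : E p → E d → ℝ) (y : E p × E p × E d) : E d :=
  hess21 G y.1 y.2.2 y.2.1 + grad2 F y.1 y.2.2

/-! ### The algorithm -/

/-- The SOBA iterates `(z^t, v^t, x^t)` with constant steps `ρ` and `γ`, started at `y₀`, when the
indices drawn at iteration `t` are `I t` (for `G`) and `J t` (for `F`). -/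
def iter {n m p d : ℕ} (F : Fin m → E p → E d → ℝ) (G : Fin n → E p → E d → ℝ) (ρ γ : ℝ)
    (y₀ : E p × E p × E d) (I : ℕ → Fin n) (J : ℕ → Fin m) : ℕ → E p × E p × E d
  | 0 => y₀
  | t + 1 =>
    let y := iter F G ρ γ y₀ I J t
    (y.1 - ρ • dirZ (G (I t)) y,
     y.2.1 - ρ • dirV (F (J t)) (G (I t)) y,
     y.2.2 - γ • dirX (F (J t)) (G (I t)) y)

/-- At each iteration the indices `I t` and `J t` are uniform and independent of each other, and
the pairs drawn at different iterations are independent. -/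
structure UniformSampling {Ω : Type*} [MeasurableSpace Ω] (P : Measure Ω) {n m : ℕ}
    (I : ℕ → Ω → Fin n) (J : ℕ → Ω → Fin m) : Prop where
  measurable_I : ∀ t, Measurable (I t)
  measurable_J : ∀ t, Measurable (J t)
  uniform_I : ∀ t i, P.real {ω | I t ω = i} = 1 / n
  uniform_J : ∀ t j, P.real {ω | J t ω = j} = 1 / m
  indep_IJ : ∀ t, IndepFun (I t) (J t) P
  indep_time : iIndepFun (fun t ω => (I t ω, J t ω)) P

/-! ### Constants -/

/-- The constants that appear in the assumptions. -/
structure Constants where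
  /-- strong convexity of `G(·, x)` -/
  μG : ℝ
  /-- Lipschitz constant of `∇F` -/
  LF1 : ℝ
  /-- Lipschitz constant of `∇²F` -/
  LF2 : ℝ
  /-- Lipschitz constant of `∇G` -/
  LG1 : ℝ
  /-- Lipschitz constant of `∇²G` -/
  LG2 : ℝ
  /-- Lipschitz constant of `∇³G` -/
  LG3 : ℝ
  /-- bound of `∇₁F` along `(z^*(x), x)` -/
  CF : ℝ
  /-- variance constant of the direction in `z` -/
  Bz : ℝ
  /-- variance constant of the direction in `v` -/
  Bv : ℝ
  /-- bound of the second moment of the direction in `x` -/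
  Bx : ℝ
  μG_pos : 0 < μG
  LF1_pos : 0 < LF1
  LF2_pos : 0 < LF2
  LG1_pos : 0 < LG1
  LG2_pos : 0 < LG2
  LG3_pos : 0 < LG3
  CF_pos : 0 < CF
  Bz_pos : 0 < Bz
  Bv_pos : 0 < Bv
  Bx_pos : 0 < Bx

namespace Constants

variable (c : Constants)

/-- `L_z` -/
def Lz : ℝ := c.LG1

/-- `ω` -/
def omega : ℝ := c.LF1 + c.LG2 * c.CF / c.μG

/-- `L_v` -/
def Lv : ℝ := √2 * max c.omega c.LG1

/-- `L_x` -/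
def Lx : ℝ := √2 * max c.omega c.LG1

/-- `L_*` -/
def Lstar : ℝ :=
  max (c.LG1 / c.μG)
    (c.CF * c.LG2 / c.μG ^ 2 * (1 + c.LG1 / c.μG) + c.LF1 / c.μG * (1 + c.LG1 / c.μG))

/-- `L_{zx}` -/
def Lzx : ℝ :=
  c.LG2 * (1 + c.Lstar) / c.μG + c.LG1 * c.LG2 * (1 + c.Lstar) / c.μG ^ 2

/-- `L_{vx}` -/
def Lvx : ℝ :=
  (c.LF2 * c.Lstar * (1 + c.Lstar) + c.Lzx * c.LF1 + c.LF2 * (1 + c.Lstar)) / c.μG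
    + 2 * ((c.LG2 + c.LF1) * (c.Lstar + 1)) / c.μG ^ 2
    + c.CF * c.LG3 * (1 + c.Lstar) / c.μG ^ 2
    + 4 * (c.CF * c.LG2 * (1 + c.Lstar)) / c.μG ^ 3

/-- `β_{vz}` -/
def betaVZ : ℝ := c.omega ^ 2 / (2 * c.μG)

/-- `φ_z' = 1 / (8 β̄_{zx})`, where `β̄_{zx} = 8 L_*² / μ_G` -/
def phiZ : ℝ := 1 / (8 * (8 * c.Lstar ^ 2 / c.μG))

/-- `φ_v' = min (1 / (8 β̄_{vx})) (μ_G φ_z' / (32 β_{vz}))`, where `β̄_{vx} = 16 L_*² / μ_G` -/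
def phiV : ℝ := min (1 / (8 * (16 * c.Lstar ^ 2 / c.μG))) (c.μG * c.phiZ / (32 * c.betaVZ))

/-- `ρ̄` -/
def rhoBar : ℝ :=
  min (min (16 / c.μG) (c.μG / (16 * c.Lz ^ 2 * c.Bz ^ 2)))
    (min (c.μG / (32 * c.Lv ^ 2 * c.Bv ^ 2)) (c.betaVZ / (c.Lv ^ 2 * c.Bv ^ 2)))

/-- `ξ` -/
def xi : ℝ :=
  √(c.μG / 4 *
    min (min (1 / c.Lzx ^ 2) (1 / c.Lvx ^ 2) * (c.Lstar ^ 2 / (c.Bx ^ 2 * c.rhoBar)))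
      (min c.phiV c.phiZ * (1 / (2 * c.Lx ^ 2))))

end Constants

/-! ### Assumptions -/

set_option maxSynthPendingDepth 3 in
/-- The regularity assumptions on `F = (1/m) ∑ F_j` and `G = (1/n) ∑ G_i`. The first two fields only
say that the derivatives of `F_j` and `G_i` used by the algorithm exist. -/
structure Regular (c : Constants) {n m p d : ℕ} (F : Fin m → E p → E d → ℝ)
    (G : Fin n → E p → E d → ℝ) : Prop where
  diff_Fj : ∀ j, Differentiable ℝ (joint (F j))
  diff_Gi : ∀ i, Differentiable ℝ (joint (G i)) ∧ Differentiable ℝ (fderiv ℝ (joint (G i)))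
  diff_F : Differentiable ℝ (joint (mean F)) ∧ Differentiable ℝ (fderiv ℝ (joint (mean F)))
  lip_F1 : ∀ y y', ‖fderiv ℝ (joint (mean F)) y - fderiv ℝ (joint (mean F)) y'‖
    ≤ c.LF1 * ‖y - y'‖
  lip_F2 : ∀ y y', ‖fderiv ℝ (fderiv ℝ (joint (mean F))) y
      - fderiv ℝ (fderiv ℝ (joint (mean F))) y'‖ ≤ c.LF2 * ‖y - y'‖
  contDiff_G : ContDiff ℝ 3 (joint (mean G))
  strongConvex_G : ∀ x, StrongConvexOn Set.univ c.μG (fun z => mean G z x)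
  lip_G1 : ∀ y y', ‖fderiv ℝ (joint (mean G)) y - fderiv ℝ (joint (mean G)) y'‖
    ≤ c.LG1 * ‖y - y'‖
  lip_G2 : ∀ y y', ‖fderiv ℝ (fderiv ℝ (joint (mean G))) y
      - fderiv ℝ (fderiv ℝ (joint (mean G))) y'‖ ≤ c.LG2 * ‖y - y'‖
  lip_G3 : ∀ y y', ‖fderiv ℝ (fderiv ℝ (fderiv ℝ (joint (mean G)))) y
      - fderiv ℝ (fderiv ℝ (fderiv ℝ (joint (mean G)))) y'‖ ≤ c.LG3 * ‖y - y'‖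
  bound_F : ∀ x, ‖grad1 (mean F) (zStar (mean G) x) x‖ ≤ c.CF

/-- The bounds on the second moments of the stochastic directions, conditionally on the current
point `Y t = (z^t, v^t, x^t)`, for the iterations `t < T`. -/
structure BoundedMoments (c : Constants) {Ω : Type*} [MeasurableSpace Ω] (P : Measure Ω)
    {n m p d : ℕ} (F : Fin m → E p → E d → ℝ) (G : Fin n → E p → E d → ℝ)
    (I : ℕ → Ω → Fin n) (J : ℕ → Ω → Fin m) (Y : ℕ → Ω → E p × E p × E d) (T : ℕ) : Prop where
  bound_z : ∀ t < T,
    P[fun ω => ‖dirZ (G (I t ω)) (Y t ω)‖ ^ 2 | MeasurableSpace.comap (Y t) inferInstance]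
      ≤ᵐ[P] fun ω => c.Bz ^ 2 * (1 + ‖dirZ (mean G) (Y t ω)‖ ^ 2)
  bound_v : ∀ t < T,
    P[fun ω => ‖dirV (F (J t ω)) (G (I t ω)) (Y t ω)‖ ^ 2 |
        MeasurableSpace.comap (Y t) inferInstance]
      ≤ᵐ[P] fun ω => c.Bv ^ 2 * (1 + ‖dirV (mean F) (mean G) (Y t ω)‖ ^ 2)
  bound_x : ∀ t < T,
    P[fun ω => ‖dirX (F (J t ω)) (G (I t ω)) (Y t ω)‖ ^ 2 |
        MeasurableSpace.comap (Y t) inferInstance]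
      ≤ᵐ[P] fun _ => c.Bx ^ 2

end

end SOBA

/-! The proof follows the Lyapunov function `lyapunov`: the gap `h - inf h` plus weighted squared
tracking errors `‖z - z^*(x)‖²` and `‖v - v^*(x)‖²`.

Landscape. Strong convexity makes `∇²₁₁G` coercive, so an unknown `u` is bounded by bounding `∇²₁₁G
u`. Applied to the equation `∇₁G = 0` for `z^*` and to the linear system for `v^*`, this shows that
both maps are Lipschitz and have first order expansions with quadratic remainder. It also yields
`∇h(x) = D_x(z^*, v^*, x)`, which is Lipschitz.

One step. The iterate at time `t` is a function of finitely many earlier draws, independent of the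
current pair, so the stochastic directions are unbiased (`UniformSampling.integral_path_pair`). In
each expansion the first order term is linear in the noise, so its expectation involves mean
directions only; the rest is of order `ρ²` (`tracking_sq_le`, `Predictable.integral_tracking_le`,
`Regular.integral_value_step_le`). The mean directions contract the tracking errors, and the choice
of `φ_z'`, `φ_v'`, `ξ` lets this contraction and the decrease of `h` absorb all coupling terms
(`Constants.drift_le`). Hence the expected Lyapunov function loses `(ξρ/2) E‖∇h‖²` and gains at most
`ρ²` times a constant plus a multiple of itself (`Regular.lyapunov_step_le`).

Summation. Since `ρ² T = ρ̄²`, a Gronwall argument (`gronwall_sum_le`) bounds the total gain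
independently of `T`, without any smallness of `ρ`. Dividing by `ρ T`, which is `ρ̄ √T`, gives the
rate. -/

namespace SOBA

/-! ### First order expansions with quadratic remainder. -/

section Analysis

variable {V W : Type*} [NormedAddCommGroup V] [NormedSpace ℝ V]
  [NormedAddCommGroup W] [NormedSpace ℝ W]

/-- Mean value inequality on the segment, where `f'` stays within `L ‖y' - y‖` of `f' y`. The factor
`1/2` is lost, which only affects constants. -/
theorem taylor_le_of_lipschitz_fderiv {f : V → W} {L : ℝ} (hf : Differentiable ℝ f)
    (hL : ∀ y y', ‖fderiv ℝ f y - fderiv ℝ f y'‖ ≤ L * ‖y - y'‖) (y y' : V) :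
    ‖f y' - f y - fderiv ℝ f y (y' - y)‖ ≤ L * ‖y' - y‖ ^ 2 := by
  have hL0 : 0 ≤ L * ‖y' - y‖ := (norm_nonneg _).trans (hL y' y)
  have key := (convex_segment (𝕜 := ℝ) y y').norm_image_sub_le_of_norm_hasFDerivWithin_le'
    (f := f) (f' := fderiv ℝ f) (φ := fderiv ℝ f y) (C := L * ‖y' - y‖)
    (fun x _ => (hf x).hasFDerivAt.hasFDerivWithinAt) ?_
    (left_mem_segment ℝ y y') (right_mem_segment ℝ y y')
  · rw [sq, ← mul_assoc]; exact key
  · rintro x ⟨a, b, ha, hb, hab, rfl⟩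
    have h1 : a • y + b • y' - y = b • (y' - y) := by
      have : a = 1 - b := by linarith
      subst this; module
    refine (hL _ _).trans ?_
    rw [h1, norm_smul, Real.norm_of_nonneg hb]
    have : b ≤ 1 := by linarith
    nlinarith

theorem norm_fderiv_le_of_lipschitz_norm {f : V → W} {L : ℝ} (hL0 : 0 ≤ L)
    (hL : ∀ y y', ‖f y - f y'‖ ≤ L * ‖y - y'‖) (y : V) : ‖fderiv ℝ f y‖ ≤ L :=
  norm_fderiv_le_of_lip' ℝ hL0 (Filter.Eventually.of_forall fun x => hL x y)

/-- This is how `z^*` and `v^*` are shown to be differentiable: an explicit candidate derivative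
replaces the implicit function theorem. -/
theorem hasFDerivAt_of_quadratic {f : V → W} {A : V →L[ℝ] W} {K : ℝ} {x : V}
    (h : ∀ x', ‖f x' - f x - A (x' - x)‖ ≤ K * ‖x' - x‖ ^ 2) : HasFDerivAt f A x := by
  rw [hasFDerivAt_iff_isLittleO]
  have h1 : (fun x' => f x' - f x - A (x' - x)) =O[nhds x] fun x' => ‖x' - x‖ ^ 2 :=
    Asymptotics.IsBigO.of_bound K (Filter.Eventually.of_forall fun x' => by
      simpa using h x')
  refine h1.trans_isLittleO ?_
  have h2 : (fun u : V => ‖u‖ ^ 2) =o[nhds 0] fun u => u := by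
    exact Asymptotics.isLittleO_norm_pow_id one_lt_two
  have h3 : Filter.Tendsto (fun x' => x' - x) (nhds x) (nhds 0) := by
    have : Continuous fun x' : V => x' - x := by fun_prop
    simpa using this.tendsto x
  exact h2.comp_tendsto h3

/-- `f` is `L`-Lipschitz and its first order expansions hold up to `K ‖x' - x‖²`. -/
structure QuadraticallyApproximable (f : V → W) (L K : ℝ) : Prop where
  lipschitz : ∀ x x', ‖f x' - f x‖ ≤ L * ‖x' - x‖
  differentiable : Differentiable ℝ f
  expansion : ∀ x x', ‖f x' - f x - fderiv ℝ f x (x' - x)‖ ≤ K * ‖x' - x‖ ^ 2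

theorem QuadraticallyApproximable.of_exists {f : V → W} {L K : ℝ}
    (hL : ∀ x x', ‖f x' - f x‖ ≤ L * ‖x' - x‖)
    (hK : ∀ x, ∃ A : V →L[ℝ] W, ∀ x', ‖f x' - f x - A (x' - x)‖ ≤ K * ‖x' - x‖ ^ 2) :
    QuadraticallyApproximable f L K where
  lipschitz := hL
  differentiable x := by
    obtain ⟨A, hA⟩ := hK x
    exact (hasFDerivAt_of_quadratic hA).differentiableAt
  expansion x x' := by
    obtain ⟨A, hA⟩ := hK x
    rw [(hasFDerivAt_of_quadratic hA).fderiv]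
    exact hA x'

theorem QuadraticallyApproximable.norm_fderiv_le {f : V → W} {L K : ℝ}
    (h : QuadraticallyApproximable f L K) (hL : 0 ≤ L) (x : V) : ‖fderiv ℝ f x‖ ≤ L :=
  norm_fderiv_le_of_lipschitz_norm hL (fun y y' => h.lipschitz y' y) x

theorem QuadraticallyApproximable.continuous {f : V → W} {L K : ℝ}
    (h : QuadraticallyApproximable f L K) : Continuous f := h.differentiable.continuous

end Analysis

/-! ### Coercive operators and strongly convex functions. -/

section Hilbert

open scoped InnerProductSpace

variable {V : Type*} [NormedAddCommGroup V] [InnerProductSpace ℝ V]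

/-- Cauchy–Schwarz. Every later estimate on `z^*` or `v^*` applies the Hessian to the unknown and
then uses this bound. -/
theorem mul_norm_le_of_coercive {H : V →L[ℝ] V} {μ : ℝ}
    (hH : ∀ u, μ * ‖u‖ ^ 2 ≤ ⟪H u, u⟫_ℝ) (u : V) : μ * ‖u‖ ≤ ‖H u‖ := by
  rcases eq_or_ne u 0 with rfl | hu
  · simp
  have h1 : μ * ‖u‖ ^ 2 ≤ ‖H u‖ * ‖u‖ := (hH u).trans (real_inner_le_norm _ _)
  have h2 : 0 < ‖u‖ := norm_pos_iff.2 hu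
  nlinarith

theorem isInvertible_of_coercive [FiniteDimensional ℝ V] {H : V →L[ℝ] V} {μ : ℝ} (hμ : 0 < μ)
    (hH : ∀ u, μ * ‖u‖ ^ 2 ≤ ⟪H u, u⟫_ℝ) : H.IsInvertible := by
  have hinj : Function.Injective H.toLinearMap := by
    rw [← LinearMap.ker_eq_bot, LinearMap.ker_eq_bot']
    intro u hu
    have h1 := mul_norm_le_of_coercive hH u
    have h2 : H u = 0 := hu
    rw [h2, norm_zero] at h1
    have : ‖u‖ = 0 := le_antisymm (by nlinarith [norm_nonneg u]) (norm_nonneg u)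
    exact norm_eq_zero.1 this
  refine ⟨(LinearEquiv.ofInjectiveEndo H.toLinearMap hinj).toContinuousLinearEquiv, ?_⟩
  ext u
  simp

theorem apply_inverse_of_coercive [FiniteDimensional ℝ V] {H : V →L[ℝ] V} {μ : ℝ} (hμ : 0 < μ)
    (hH : ∀ u, μ * ‖u‖ ^ 2 ≤ ⟪H u, u⟫_ℝ) (w : V) : H (H.inverse w) = w := by
  obtain ⟨e, rfl⟩ := isInvertible_of_coercive hμ hH
  simp

theorem norm_inverse_apply_le_of_coercive [FiniteDimensional ℝ V] {H : V →L[ℝ] V} {μ : ℝ}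
    (hμ : 0 < μ) (hH : ∀ u, μ * ‖u‖ ^ 2 ≤ ⟪H u, u⟫_ℝ) (w : V) : ‖H.inverse w‖ ≤ ‖w‖ / μ := by
  have := mul_norm_le_of_coercive hH (H.inverse w)
  rw [apply_inverse_of_coercive hμ hH] at this
  rw [le_div_iff₀ hμ]; linarith

/-- Monotonicity between `x` and `x + t u`, divided by `t²`, as `t` decreases to `0`. -/
theorem coercive_fderiv_of_strongly_monotone {g : V → V} {μ : ℝ} {x : V}
    (hg : ∀ x y, μ * ‖y - x‖ ^ 2 ≤ ⟪g y - g x, y - x⟫_ℝ) (hd : DifferentiableAt ℝ g x) (u : V) :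
    μ * ‖u‖ ^ 2 ≤ ⟪fderiv ℝ g x u, u⟫_ℝ := by
  have hline : HasDerivAt (fun t : ℝ => g (x + t • u)) (fderiv ℝ g x u) 0 := by
    have h1 : HasDerivAt (fun t : ℝ => x + t • u) u 0 := by
      simpa using ((hasDerivAt_id (0 : ℝ)).smul_const u).const_add x
    have h2 : HasFDerivAt g (fderiv ℝ g x) (x + (0 : ℝ) • u) := by
      simpa using hd.hasFDerivAt
    exact h2.comp_hasDerivAt 0 h1
  have hslope := hline.tendsto_slope_zero_right
  have h2 := hslope.inner (𝕜 := ℝ) (tendsto_const_nhds (x := u))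
  refine ge_of_tendsto h2 ?_
  filter_upwards [self_mem_nhdsWithin] with t ht
  have ht : 0 < t := ht
  have h3 := hg x (x + t • u)
  simp only [zero_add, zero_smul, add_zero, add_sub_cancel_left] at h3 ⊢
  rw [real_inner_smul_left]
  rw [real_inner_smul_right, norm_smul, Real.norm_of_nonneg ht.le] at h3
  rw [le_inv_mul_iff₀ ht]
  have : t * (t * (μ * ‖u‖ ^ 2)) ≤ t * ⟪g (x + t • u) - g x, u⟫_ℝ := by nlinarith
  exact le_of_mul_le_mul_left this ht

variable [CompleteSpace V]

/-- Strong convexity at `x + t (y - x)` bounds the difference quotient at `x` for `t` in `(0, 1]`;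
then `t` tends to `0`. -/
theorem strongConvexOn_gradient_inequality {f : V → ℝ} {m : ℝ}
    (hf : StrongConvexOn Set.univ m f) (hd : Differentiable ℝ f) (x y : V) :
    f x + ⟪gradient f x, y - x⟫_ℝ + m / 2 * ‖y - x‖ ^ 2 ≤ f y := by
  have hline : HasDerivAt (fun t : ℝ => f (x + t • (y - x))) (fderiv ℝ f x (y - x)) 0 := by
    have h1 : HasDerivAt (fun t : ℝ => x + t • (y - x)) (y - x) 0 := by
      simpa using ((hasDerivAt_id (0 : ℝ)).smul_const (y - x)).const_add x
    have h2 : HasFDerivAt f (fderiv ℝ f x) (x + (0 : ℝ) • (y - x)) := by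
      simpa using (hd x).hasFDerivAt
    exact h2.comp_hasDerivAt 0 h1
  have hslope := hline.tendsto_slope_zero_right
  have hlim : Filter.Tendsto (fun t : ℝ => f y - f x - (1 - t) * (m / 2 * ‖y - x‖ ^ 2))
      (nhdsWithin 0 (Set.Ioi 0)) (nhds (f y - f x - (1 - 0) * (m / 2 * ‖y - x‖ ^ 2))) := by
    refine Filter.Tendsto.mono_left ?_ nhdsWithin_le_nhds
    have : Continuous fun t : ℝ => f y - f x - (1 - t) * (m / 2 * ‖y - x‖ ^ 2) := by fun_prop
    exact this.tendsto 0
  have hle := le_of_tendsto_of_tendsto hslope hlim ?_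
  · have : ⟪gradient f x, y - x⟫_ℝ = fderiv ℝ f x (y - x) := inner_gradient_left
    rw [this]; linarith
  · have h1 : Set.Ioc (0 : ℝ) 1 ∈ nhdsWithin (0 : ℝ) (Set.Ioi 0) := Ioc_mem_nhdsGT one_pos
    filter_upwards [h1] with t ht
    have hf2 := hf.2
    have h2 := hf2 (Set.mem_univ x) (Set.mem_univ y) (a := 1 - t) (b := t)
      (by linarith [ht.2]) ht.1.le (by ring)
    have h3 : (1 - t) • x + t • y = x + t • (y - x) := by module
    rw [h3, norm_sub_rev x y] at h2
    simp only [smul_eq_mul] at h2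
    simp only [zero_add, zero_smul, add_zero, smul_eq_mul]
    rw [inv_mul_le_iff₀ ht.1]
    nlinarith

theorem strongConvexOn_strongly_monotone {f : V → ℝ} {m : ℝ}
    (hf : StrongConvexOn Set.univ m f) (hd : Differentiable ℝ f) (x y : V) :
    m * ‖y - x‖ ^ 2 ≤ ⟪gradient f y - gradient f x, y - x⟫_ℝ := by
  have h1 := strongConvexOn_gradient_inequality hf hd x y
  have h2 := strongConvexOn_gradient_inequality hf hd y x
  have h3 : ⟪gradient f y, x - y⟫_ℝ = - ⟪gradient f y, y - x⟫_ℝ := by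
    rw [← inner_neg_right, neg_sub]
  rw [norm_sub_rev x y] at h2
  rw [inner_sub_left]
  linarith

/-- The gradient inequality at `0` bounds `f` below by a quadratic in the norm, so the continuous
function `f` is coercive. -/
theorem strongConvexOn_exists_isMinOn [FiniteDimensional ℝ V] {f : V → ℝ} {m : ℝ} (hm : 0 < m)
    (hf : StrongConvexOn Set.univ m f) (hd : Differentiable ℝ f) :
    ∃ z, IsMinOn f Set.univ z := by
  have hcoer : Filter.Tendsto f (Filter.cocompact V) Filter.atTop := by
    have hn := tendsto_norm_cocompact_atTop (E := V)
    have hq : Filter.Tendsto (fun r : ℝ => f 0 + r * (m / 2 * r - ‖gradient f 0‖))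
        Filter.atTop Filter.atTop := by
      refine Filter.tendsto_atTop_add_const_left _ _ ?_
      refine Filter.tendsto_id.atTop_mul_atTop₀ ?_
      refine Filter.tendsto_atTop_add_const_right _ _ ?_
      exact Filter.tendsto_id.const_mul_atTop (by positivity)
    refine Filter.tendsto_atTop_mono (fun u => ?_) (hq.comp hn)
    have h1 := strongConvexOn_gradient_inequality hf hd 0 u
    have h2 := neg_le_of_abs_le (abs_real_inner_le_norm (gradient f 0) (u - 0))
    simp only [sub_zero] at h1 h2
    simp only [Function.comp]
    nlinarith
  obtain ⟨z, hz⟩ := hd.continuous.exists_forall_le hcoer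
  exact ⟨z, fun u _ => hz u⟩

end Hilbert

end SOBA

namespace SOBA

/-! ### Partial derivatives as restrictions of the joint derivative. -/

noncomputable section JointCalculus

open scoped InnerProductSpace

set_option maxSynthPendingDepth 3

variable {p d : ℕ}

instance : ContinuousSMul ℝ (WithLp 2 (E p × E d)) := IsBoundedSMul.continuousSMul

/-- The point `(z, x)` of `ℝ^p × ℝ^d` with its Euclidean norm. -/
def pt (z : E p) (x : E d) : WithLp 2 (E p × E d) := WithLp.toLp 2 (z, x)

/-- The inclusion `z ↦ (z, 0)`. -/
def inZ (p d : ℕ) : E p →L[ℝ] WithLp 2 (E p × E d) :=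
  (WithLp.prodContinuousLinearEquiv 2 ℝ (E p) (E d)).symm.toContinuousLinearMap ∘L
    ContinuousLinearMap.inl ℝ (E p) (E d)

/-- The inclusion `x ↦ (0, x)`. -/
def inX (p d : ℕ) : E d →L[ℝ] WithLp 2 (E p × E d) :=
  (WithLp.prodContinuousLinearEquiv 2 ℝ (E p) (E d)).symm.toContinuousLinearMap ∘L
    ContinuousLinearMap.inr ℝ (E p) (E d)

theorem pt_eq (z : E p) (x : E d) : pt z x = inZ p d z + inX p d x := by
  simp only [pt, inZ, inX, ContinuousLinearMap.comp_apply, ContinuousLinearMap.inl_apply,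
    ContinuousLinearMap.inr_apply, ContinuousLinearEquiv.coe_coe]
  rw [← map_add]
  simp

theorem pt_sub_pt (z z' : E p) (x x' : E d) :
    pt z' x' - pt z x = inZ p d (z' - z) + inX p d (x' - x) := by
  simp only [pt_eq, map_sub]; abel

theorem norm_inZ_apply (u : E p) : ‖inZ p d u‖ = ‖u‖ := by
  have : inZ p d u = WithLp.toLp 2 (u, 0) := rfl
  rw [this, WithLp.prod_norm_eq_of_L2]
  simp

theorem norm_inX_apply (u : E d) : ‖inX p d u‖ = ‖u‖ := by
  have : inX p d u = WithLp.toLp 2 (0, u) := rfl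
  rw [this, WithLp.prod_norm_eq_of_L2]
  simp

theorem norm_pt_sub_pt_le (z z' : E p) (x x' : E d) :
    ‖pt z' x' - pt z x‖ ≤ ‖z' - z‖ + ‖x' - x‖ := by
  rw [pt_sub_pt]
  refine (norm_add_le _ _).trans ?_
  rw [norm_inZ_apply, norm_inX_apply]

/-- The linear form `l` restricted to the first factor, represented by a vector. -/
def rieszZ (p d : ℕ) : (WithLp 2 (E p × E d) →L[ℝ] ℝ) →L[ℝ] E p :=
  LinearMap.mkContinuous
    { toFun := fun l => (InnerProductSpace.toDual ℝ (E p)).symm (l ∘L inZ p d)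
      map_add' := fun l l' => by rw [ContinuousLinearMap.add_comp, map_add]
      map_smul' := fun a l => by
        rw [ContinuousLinearMap.smul_comp]; simp } 1 (fun l => by
      simp only [LinearMap.coe_mk, AddHom.coe_mk, LinearIsometryEquiv.norm_map, one_mul]
      refine ContinuousLinearMap.opNorm_le_bound _ (norm_nonneg _) fun u => ?_
      rw [← norm_inZ_apply (d := d) u]
      exact l.le_opNorm _)

/-- The linear form `l` restricted to the second factor, represented by a vector. -/
def rieszX (p d : ℕ) : (WithLp 2 (E p × E d) →L[ℝ] ℝ) →L[ℝ] E d :=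
  LinearMap.mkContinuous
    { toFun := fun l => (InnerProductSpace.toDual ℝ (E d)).symm (l ∘L inX p d)
      map_add' := fun l l' => by rw [ContinuousLinearMap.add_comp, map_add]
      map_smul' := fun a l => by
        rw [ContinuousLinearMap.smul_comp]; simp } 1 (fun l => by
      simp only [LinearMap.coe_mk, AddHom.coe_mk, LinearIsometryEquiv.norm_map, one_mul]
      refine ContinuousLinearMap.opNorm_le_bound _ (norm_nonneg _) fun u => ?_
      rw [← norm_inX_apply (p := p) u]
      exact l.le_opNorm _)

theorem inner_rieszZ (l : WithLp 2 (E p × E d) →L[ℝ] ℝ) (u : E p) :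
    ⟪rieszZ p d l, u⟫_ℝ = l (inZ p d u) := by
  change ⟪(InnerProductSpace.toDual ℝ (E p)).symm (l ∘L inZ p d), u⟫_ℝ = _
  rw [InnerProductSpace.toDual_symm_apply]; rfl

theorem inner_rieszX (l : WithLp 2 (E p × E d) →L[ℝ] ℝ) (u : E d) :
    ⟪rieszX p d l, u⟫_ℝ = l (inX p d u) := by
  change ⟪(InnerProductSpace.toDual ℝ (E d)).symm (l ∘L inX p d), u⟫_ℝ = _
  rw [InnerProductSpace.toDual_symm_apply]; rfl

theorem norm_rieszZ_apply_le (l : WithLp 2 (E p × E d) →L[ℝ] ℝ) : ‖rieszZ p d l‖ ≤ ‖l‖ := by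
  have := (rieszZ p d).le_of_opNorm_le (LinearMap.mkContinuous_norm_le _ zero_le_one _) l
  simpa using this

theorem norm_rieszX_apply_le (l : WithLp 2 (E p × E d) →L[ℝ] ℝ) : ‖rieszX p d l‖ ≤ ‖l‖ := by
  have := (rieszX p d).le_of_opNorm_le (LinearMap.mkContinuous_norm_le _ zero_le_one _) l
  simpa using this

variable {f : E p → E d → ℝ}

theorem hasFDerivAt_pt_left (z : E p) (x : E d) :
    HasFDerivAt (fun z' => pt z' x) (inZ p d) z := by
  simp only [pt_eq]
  exact ((inZ p d).hasFDerivAt).add_const _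

theorem hasFDerivAt_pt_right (z : E p) (x : E d) :
    HasFDerivAt (fun x' => pt z x') (inX p d) x := by
  simp only [pt_eq]
  exact ((inX p d).hasFDerivAt).const_add _

theorem hasFDerivAt_left (hf : Differentiable ℝ (joint f)) (z : E p) (x : E d) :
    HasFDerivAt (fun z' => f z' x) (fderiv ℝ (joint f) (pt z x) ∘L inZ p d) z :=
  HasFDerivAt.comp (g := joint f) z (hf (pt z x)).hasFDerivAt (hasFDerivAt_pt_left z x)

theorem hasFDerivAt_right (hf : Differentiable ℝ (joint f)) (z : E p) (x : E d) :
    HasFDerivAt (fun x' => f z x') (fderiv ℝ (joint f) (pt z x) ∘L inX p d) x :=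
  HasFDerivAt.comp (g := joint f) x (hf (pt z x)).hasFDerivAt (hasFDerivAt_pt_right z x)

theorem grad1_eq (hf : Differentiable ℝ (joint f)) (z : E p) (x : E d) :
    grad1 f z x = rieszZ p d (fderiv ℝ (joint f) (pt z x)) := by
  rw [grad1, gradient, (hasFDerivAt_left hf z x).fderiv]; rfl

theorem grad2_eq (hf : Differentiable ℝ (joint f)) (z : E p) (x : E d) :
    grad2 f z x = rieszX p d (fderiv ℝ (joint f) (pt z x)) := by
  rw [grad2, gradient, (hasFDerivAt_right hf z x).fderiv]; rfl

theorem hasFDerivAt_grad1 (hf : Differentiable ℝ (joint f))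
    (hf2 : Differentiable ℝ (fderiv ℝ (joint f))) (z : E p) (x : E d) :
    HasFDerivAt (fun z' => grad1 f z' x)
      (rieszZ p d ∘L fderiv ℝ (fderiv ℝ (joint f)) (pt z x) ∘L inZ p d) z := by
  simp only [grad1_eq hf]
  exact (rieszZ p d).hasFDerivAt.comp z
    ((hf2 (pt z x)).hasFDerivAt.comp z (hasFDerivAt_pt_left z x))

theorem hess11_eq (hf : Differentiable ℝ (joint f))
    (hf2 : Differentiable ℝ (fderiv ℝ (joint f))) (z : E p) (x : E d) :
    hess11 f z x = rieszZ p d ∘L fderiv ℝ (fderiv ℝ (joint f)) (pt z x) ∘L inZ p d :=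
  (hasFDerivAt_grad1 hf hf2 z x).fderiv

theorem hasFDerivAt_grad2 (hf : Differentiable ℝ (joint f))
    (hf2 : Differentiable ℝ (fderiv ℝ (joint f))) (z : E p) (x : E d) :
    HasFDerivAt (fun z' => grad2 f z' x)
      (rieszX p d ∘L fderiv ℝ (fderiv ℝ (joint f)) (pt z x) ∘L inZ p d) z := by
  simp only [grad2_eq hf]
  exact (rieszX p d).hasFDerivAt.comp z
    ((hf2 (pt z x)).hasFDerivAt.comp z (hasFDerivAt_pt_left z x))

theorem hess21_eq (hf : Differentiable ℝ (joint f))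
    (hf2 : Differentiable ℝ (fderiv ℝ (joint f))) (z : E p) (x : E d) :
    hess21 f z x = rieszX p d ∘L fderiv ℝ (fderiv ℝ (joint f)) (pt z x) ∘L inZ p d :=
  (hasFDerivAt_grad2 hf hf2 z x).fderiv

/-- Since `inZ` is isometric and `rieszZ` does not increase norms, partial derivatives inherit the
joint Lipschitz constants; the next bounds rest on the same fact. -/
theorem norm_grad1_sub_le (hf : Differentiable ℝ (joint f)) {L : ℝ}
    (hL : ∀ y y', ‖fderiv ℝ (joint f) y - fderiv ℝ (joint f) y'‖ ≤ L * ‖y - y'‖)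
    (z z' : E p) (x x' : E d) :
    ‖grad1 f z' x' - grad1 f z x‖ ≤ L * ‖pt z' x' - pt z x‖ := by
  rw [grad1_eq hf, grad1_eq hf, ← map_sub]
  exact (norm_rieszZ_apply_le _).trans (hL _ _)

theorem norm_grad2_sub_le (hf : Differentiable ℝ (joint f)) {L : ℝ}
    (hL : ∀ y y', ‖fderiv ℝ (joint f) y - fderiv ℝ (joint f) y'‖ ≤ L * ‖y - y'‖)
    (z z' : E p) (x x' : E d) :
    ‖grad2 f z' x' - grad2 f z x‖ ≤ L * ‖pt z' x' - pt z x‖ := by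
  rw [grad2_eq hf, grad2_eq hf, ← map_sub]
  exact (norm_rieszX_apply_le _).trans (hL _ _)

theorem norm_hess11_apply_le (hf : Differentiable ℝ (joint f))
    (hf2 : Differentiable ℝ (fderiv ℝ (joint f))) {L : ℝ}
    (hL : ∀ y, ‖fderiv ℝ (fderiv ℝ (joint f)) y‖ ≤ L) (z : E p) (x : E d) (u : E p) :
    ‖hess11 f z x u‖ ≤ L * ‖u‖ := by
  rw [hess11_eq hf hf2, ← norm_inZ_apply (d := d) u]
  exact (norm_rieszZ_apply_le _).trans (ContinuousLinearMap.le_of_opNorm_le _ (hL _) _)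

theorem norm_hess21_apply_le (hf : Differentiable ℝ (joint f))
    (hf2 : Differentiable ℝ (fderiv ℝ (joint f))) {L : ℝ}
    (hL : ∀ y, ‖fderiv ℝ (fderiv ℝ (joint f)) y‖ ≤ L) (z : E p) (x : E d) (u : E p) :
    ‖hess21 f z x u‖ ≤ L * ‖u‖ := by
  rw [hess21_eq hf hf2, ← norm_inZ_apply (d := d) u]
  exact (norm_rieszX_apply_le _).trans (ContinuousLinearMap.le_of_opNorm_le _ (hL _) _)

theorem norm_hess11_sub_apply_le (hf : Differentiable ℝ (joint f))
    (hf2 : Differentiable ℝ (fderiv ℝ (joint f))) {L : ℝ}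
    (hL : ∀ y y', ‖fderiv ℝ (fderiv ℝ (joint f)) y - fderiv ℝ (fderiv ℝ (joint f)) y'‖
      ≤ L * ‖y - y'‖) (z z' : E p) (x x' : E d) (u : E p) :
    ‖hess11 f z' x' u - hess11 f z x u‖ ≤ L * ‖pt z' x' - pt z x‖ * ‖u‖ := by
  rw [hess11_eq hf hf2, hess11_eq hf hf2, ← norm_inZ_apply (d := d) u]
  simp only [ContinuousLinearMap.comp_apply]
  rw [← map_sub, ← sub_apply]
  exact (norm_rieszZ_apply_le _).trans (ContinuousLinearMap.le_of_opNorm_le _ (hL _ _) _)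

theorem norm_hess21_sub_apply_le (hf : Differentiable ℝ (joint f))
    (hf2 : Differentiable ℝ (fderiv ℝ (joint f))) {L : ℝ}
    (hL : ∀ y y', ‖fderiv ℝ (fderiv ℝ (joint f)) y - fderiv ℝ (fderiv ℝ (joint f)) y'‖
      ≤ L * ‖y - y'‖) (z z' : E p) (x x' : E d) (u : E p) :
    ‖hess21 f z' x' u - hess21 f z x u‖ ≤ L * ‖pt z' x' - pt z x‖ * ‖u‖ := by
  rw [hess21_eq hf hf2, hess21_eq hf hf2, ← norm_inZ_apply (d := d) u]
  simp only [ContinuousLinearMap.comp_apply]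
  rw [← map_sub, ← sub_apply]
  exact (norm_rieszX_apply_le _).trans (ContinuousLinearMap.le_of_opNorm_le _ (hL _ _) _)

variable {k : ℕ} {g : Fin k → E p → E d → ℝ}

theorem hasFDerivAt_smul_sum {V W : Type*} [NormedAddCommGroup V] [NormedSpace ℝ V]
    [NormedAddCommGroup W] [NormedSpace ℝ W] {φ : Fin k → V → W} {φ' : Fin k → V →L[ℝ] W} {y : V}
    (h : ∀ i, HasFDerivAt (φ i) (φ' i) y) (a : ℝ) :
    HasFDerivAt (fun y => a • ∑ i, φ i y) (a • ∑ i, φ' i) y :=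
  (HasFDerivAt.fun_sum fun i _ => h i).const_smul a

theorem hasFDerivAt_joint_mean (hg : ∀ i, Differentiable ℝ (joint (g i)))
    (y : WithLp 2 (E p × E d)) :
    HasFDerivAt (joint (mean g)) ((k : ℝ)⁻¹ • ∑ i, fderiv ℝ (joint (g i)) y) y := by
  have h1 (i : Fin k) : HasFDerivAt (joint (g i)) (fderiv ℝ (joint (g i)) y) y :=
    (hg i).differentiableAt.hasFDerivAt
  exact hasFDerivAt_smul_sum (φ := fun i => joint (g i)) (φ' := fun i => fderiv ℝ (joint (g i)) y)
    h1 _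

theorem fderiv_joint_mean (hg : ∀ i, Differentiable ℝ (joint (g i))) (y : WithLp 2 (E p × E d)) :
    fderiv ℝ (joint (mean g)) y = (k : ℝ)⁻¹ • ∑ i, fderiv ℝ (joint (g i)) y :=
  (hasFDerivAt_joint_mean hg y).fderiv

theorem hasFDerivAt_fderiv_joint_mean (hg : ∀ i, Differentiable ℝ (joint (g i)))
    (hg2 : ∀ i, Differentiable ℝ (fderiv ℝ (joint (g i)))) (y : WithLp 2 (E p × E d)) :
    HasFDerivAt (fderiv ℝ (joint (mean g)))
      ((k : ℝ)⁻¹ • ∑ i, fderiv ℝ (fderiv ℝ (joint (g i))) y) y := by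
  have h1 (i : Fin k) : HasFDerivAt (fderiv ℝ (joint (g i)))
      (fderiv ℝ (fderiv ℝ (joint (g i))) y) y := (hg2 i).differentiableAt.hasFDerivAt
  rw [funext (fderiv_joint_mean hg)]
  exact hasFDerivAt_smul_sum (φ := fun i => fderiv ℝ (joint (g i)))
    (φ' := fun i => fderiv ℝ (fderiv ℝ (joint (g i))) y) h1 _

theorem fderiv_fderiv_joint_mean (hg : ∀ i, Differentiable ℝ (joint (g i)))
    (hg2 : ∀ i, Differentiable ℝ (fderiv ℝ (joint (g i)))) (y : WithLp 2 (E p × E d)) :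
    fderiv ℝ (fderiv ℝ (joint (mean g))) y
      = (k : ℝ)⁻¹ • ∑ i, fderiv ℝ (fderiv ℝ (joint (g i))) y :=
  (hasFDerivAt_fderiv_joint_mean hg hg2 y).fderiv

theorem differentiable_joint_mean (hg : ∀ i, Differentiable ℝ (joint (g i))) :
    Differentiable ℝ (joint (mean g)) :=
  fun y => (hasFDerivAt_joint_mean hg y).differentiableAt

theorem differentiable_fderiv_joint_mean (hg : ∀ i, Differentiable ℝ (joint (g i)))
    (hg2 : ∀ i, Differentiable ℝ (fderiv ℝ (joint (g i)))) :
    Differentiable ℝ (fderiv ℝ (joint (mean g))) :=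
  fun y => (hasFDerivAt_fderiv_joint_mean hg hg2 y).differentiableAt

/-- The mean formulas from here on are what makes the stochastic directions unbiased. -/
theorem grad1_mean (hg : ∀ i, Differentiable ℝ (joint (g i))) (z : E p) (x : E d) :
    grad1 (mean g) z x = (k : ℝ)⁻¹ • ∑ i, grad1 (g i) z x := by
  rw [grad1_eq (differentiable_joint_mean hg), fderiv_joint_mean hg, map_smul, map_sum]
  simp only [grad1_eq (hg _)]

theorem grad2_mean (hg : ∀ i, Differentiable ℝ (joint (g i))) (z : E p) (x : E d) :
    grad2 (mean g) z x = (k : ℝ)⁻¹ • ∑ i, grad2 (g i) z x := by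
  rw [grad2_eq (differentiable_joint_mean hg), fderiv_joint_mean hg, map_smul, map_sum]
  simp only [grad2_eq (hg _)]

theorem hess11_mean_apply (hg : ∀ i, Differentiable ℝ (joint (g i)))
    (hg2 : ∀ i, Differentiable ℝ (fderiv ℝ (joint (g i)))) (z : E p) (x : E d) (u : E p) :
    hess11 (mean g) z x u = (k : ℝ)⁻¹ • ∑ i, hess11 (g i) z x u := by
  rw [hess11_eq (differentiable_joint_mean hg) (differentiable_fderiv_joint_mean hg hg2)]
  simp only [hess11_eq (hg _) (hg2 _), ContinuousLinearMap.comp_apply,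
    fderiv_fderiv_joint_mean hg hg2, smul_apply, sum_apply,
    map_smul, map_sum]

theorem hess21_mean_apply (hg : ∀ i, Differentiable ℝ (joint (g i)))
    (hg2 : ∀ i, Differentiable ℝ (fderiv ℝ (joint (g i)))) (z : E p) (x : E d) (u : E p) :
    hess21 (mean g) z x u = (k : ℝ)⁻¹ • ∑ i, hess21 (g i) z x u := by
  rw [hess21_eq (differentiable_joint_mean hg) (differentiable_fderiv_joint_mean hg hg2)]
  simp only [hess21_eq (hg _) (hg2 _), ContinuousLinearMap.comp_apply,
    fderiv_fderiv_joint_mean hg hg2, smul_apply, sum_apply,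
    map_smul, map_sum]

end JointCalculus

end SOBA

namespace SOBA

/-! ### Regularity of `z^*`. -/

noncomputable section Landscape

open scoped InnerProductSpace

set_option maxSynthPendingDepth 3

variable {p d : ℕ}

/-- The regularity assumptions on `F` and `G` themselves, forgetting that they are means. -/
structure RegularPair (c : Constants) (F G : E p → E d → ℝ) : Prop where
  diff_F : Differentiable ℝ (joint F)
  diff_F1 : Differentiable ℝ (fderiv ℝ (joint F))
  lip_F1 : ∀ y y', ‖fderiv ℝ (joint F) y - fderiv ℝ (joint F) y'‖ ≤ c.LF1 * ‖y - y'‖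
  lip_F2 : ∀ y y', ‖fderiv ℝ (fderiv ℝ (joint F)) y - fderiv ℝ (fderiv ℝ (joint F)) y'‖
    ≤ c.LF2 * ‖y - y'‖
  diff_G : Differentiable ℝ (joint G)
  diff_G1 : Differentiable ℝ (fderiv ℝ (joint G))
  diff_G2 : Differentiable ℝ (fderiv ℝ (fderiv ℝ (joint G)))
  symm_G : ∀ y u w, fderiv ℝ (fderiv ℝ (joint G)) y u w = fderiv ℝ (fderiv ℝ (joint G)) y w u
  strongConvex_G : ∀ x, StrongConvexOn Set.univ c.μG (fun z => G z x)
  lip_G1 : ∀ y y', ‖fderiv ℝ (joint G) y - fderiv ℝ (joint G) y'‖ ≤ c.LG1 * ‖y - y'‖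
  lip_G2 : ∀ y y', ‖fderiv ℝ (fderiv ℝ (joint G)) y - fderiv ℝ (fderiv ℝ (joint G)) y'‖
    ≤ c.LG2 * ‖y - y'‖
  lip_G3 : ∀ y y', ‖fderiv ℝ (fderiv ℝ (fderiv ℝ (joint G))) y
      - fderiv ℝ (fderiv ℝ (fderiv ℝ (joint G))) y'‖ ≤ c.LG3 * ‖y - y'‖
  bound_F : ∀ x, ‖grad1 F (zStar G x) x‖ ≤ c.CF

theorem Regular.regularPair {c : Constants} {n m : ℕ} {F : Fin m → E p → E d → ℝ}
    {G : Fin n → E p → E d → ℝ} (h : Regular c F G) : RegularPair c (mean F) (mean G) where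
  diff_F := h.diff_F.1
  diff_F1 := h.diff_F.2
  lip_F1 := h.lip_F1
  lip_F2 := h.lip_F2
  diff_G := h.contDiff_G.differentiable (by norm_num)
  diff_G1 := (h.contDiff_G.fderiv_right (m := 2) (by norm_num)).differentiable (by norm_num)
  diff_G2 := ((h.contDiff_G.fderiv_right (m := 2) (by norm_num)).fderiv_right (m := 1)
    (by norm_num)).differentiable (by norm_num)
  symm_G y u w := (h.contDiff_G.contDiffAt.isSymmSndFDerivAt (by simp; norm_num)) u w
  strongConvex_G := h.strongConvex_G
  lip_G1 := h.lip_G1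
  lip_G2 := h.lip_G2
  lip_G3 := h.lip_G3
  bound_F := h.bound_F

namespace Constants

variable (c : Constants)

/-- Lipschitz constant of `x ↦ (z^*(x), x)`. -/
def lipGraph : ℝ := 1 + c.LG1 / c.μG

/-- Bound of `‖v^*‖`. -/
def boundV : ℝ := c.CF / c.μG

/-- Lipschitz constant of `v^*`. -/
def lipV : ℝ := (c.LG2 * c.lipGraph * c.boundV + c.LF1 * c.lipGraph) / c.μG

/-- Constant of the quadratic expansion of `z^*`. -/
def quadZ : ℝ := c.LG2 * c.lipGraph ^ 2 / c.μG

/-- Constant of the quadratic expansion of `v^*`. -/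
def quadV : ℝ :=
  (c.LF2 * c.lipGraph ^ 2 + c.LG3 * c.lipGraph ^ 2 * c.boundV + c.LG2 * c.lipGraph * c.lipV
    + (c.LF1 + c.LG2 * c.boundV) * c.quadZ) / c.μG

/-- Lipschitz constant of `∇h`. -/
def lipGradH : ℝ :=
  c.LG2 * c.lipGraph * c.boundV + c.LG1 * c.lipV + c.LF1 * c.lipGraph

theorem lipGraph_pos : 0 < c.lipGraph := by
  have := c.LG1_pos; have := c.μG_pos; unfold lipGraph; positivity

theorem boundV_pos : 0 < c.boundV := by
  have := c.CF_pos; have := c.μG_pos; unfold boundV; positivity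

theorem lipV_pos : 0 < c.lipV := by
  have := c.LG2_pos; have := c.μG_pos; have := c.LF1_pos; have := c.lipGraph_pos
  have := c.boundV_pos; unfold lipV; positivity

theorem quadZ_pos : 0 < c.quadZ := by
  have := c.LG2_pos; have := c.μG_pos; have := c.lipGraph_pos; unfold quadZ; positivity

theorem quadV_pos : 0 < c.quadV := by
  have := c.LG2_pos; have := c.μG_pos; have := c.LF1_pos; have := c.lipGraph_pos
  have := c.LF2_pos; have := c.LG3_pos; have := c.lipV_pos; have := c.quadZ_pos
  have := c.boundV_pos; unfold quadV; positivity

theorem lipGradH_pos : 0 < c.lipGradH := by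
  have := c.LG2_pos; have := c.LG1_pos; have := c.LF1_pos; have := c.lipGraph_pos
  have := c.lipV_pos; have := c.boundV_pos; unfold lipGradH; positivity

theorem omega_pos : 0 < c.omega := by
  have := c.LF1_pos; have := c.LG2_pos; have := c.CF_pos; have := c.μG_pos
  unfold omega; positivity

theorem omega_eq : c.omega = c.LF1 + c.LG2 * c.boundV := by
  unfold omega boundV; ring

theorem lipZ_le_Lstar : c.LG1 / c.μG ≤ c.Lstar := le_max_left _ _

theorem lipV_le_Lstar : c.lipV ≤ c.Lstar := by
  refine le_trans (le_of_eq ?_) (le_max_right _ _)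
  have := c.μG_pos
  unfold lipV lipGraph boundV
  field_simp

theorem Lstar_pos : 0 < c.Lstar := c.lipV_pos.trans_le c.lipV_le_Lstar

end Constants

namespace RegularPair

variable {c : Constants} {F G : E p → E d → ℝ} (hR : RegularPair c F G)
include hR

theorem norm_fderiv2_F_le (y : WithLp 2 (E p × E d)) :
    ‖fderiv ℝ (fderiv ℝ (joint F)) y‖ ≤ c.LF1 :=
  norm_fderiv_le_of_lipschitz_norm c.LF1_pos.le hR.lip_F1 y

theorem norm_fderiv2_G_le (y : WithLp 2 (E p × E d)) :
    ‖fderiv ℝ (fderiv ℝ (joint G)) y‖ ≤ c.LG1 :=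
  norm_fderiv_le_of_lipschitz_norm c.LG1_pos.le hR.lip_G1 y

theorem norm_fderiv3_G_le (y : WithLp 2 (E p × E d)) :
    ‖fderiv ℝ (fderiv ℝ (fderiv ℝ (joint G))) y‖ ≤ c.LG2 :=
  norm_fderiv_le_of_lipschitz_norm c.LG2_pos.le hR.lip_G2 y

theorem differentiable_left (x : E d) : Differentiable ℝ fun z => G z x :=
  fun z => (hasFDerivAt_left hR.diff_G z x).differentiableAt

theorem strongly_monotone (x : E d) (z z' : E p) :
    c.μG * ‖z' - z‖ ^ 2 ≤ ⟪grad1 G z' x - grad1 G z x, z' - z⟫_ℝ :=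
  strongConvexOn_strongly_monotone (hR.strongConvex_G x) (hR.differentiable_left x) z z'

/-- The choice operator in `zStar` is meaningful only because a minimizer exists. -/
theorem isMinOn_zStar (x : E d) : IsMinOn (fun z => G z x) Set.univ (zStar G x) :=
  Classical.epsilon_spec (strongConvexOn_exists_isMinOn c.μG_pos (hR.strongConvex_G x)
    (hR.differentiable_left x))

theorem grad1_zStar (x : E d) : grad1 G (zStar G x) x = 0 := by
  have h1 : IsLocalMin (fun z => G z x) (zStar G x) :=
    (hR.isMinOn_zStar x).isLocalMin Filter.univ_mem
  rw [grad1, gradient, h1.fderiv_eq_zero, map_zero]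

theorem hess11_coercive (z : E p) (x : E d) (u : E p) :
    c.μG * ‖u‖ ^ 2 ≤ ⟪hess11 G z x u, u⟫_ℝ :=
  coercive_fderiv_of_strongly_monotone (hR.strongly_monotone x)
    (hasFDerivAt_grad1 hR.diff_G hR.diff_G1 z x).differentiableAt u

theorem hess11_vStar (x : E d) :
    hess11 G (zStar G x) x (vStar F G x) = -grad1 F (zStar G x) x := by
  rw [vStar, map_neg, apply_inverse_of_coercive c.μG_pos (hR.hess11_coercive _ x)]

theorem norm_vStar_le (x : E d) : ‖vStar F G x‖ ≤ c.boundV := by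
  rw [vStar, norm_neg]
  refine (norm_inverse_apply_le_of_coercive c.μG_pos (hR.hess11_coercive _ x) _).trans ?_
  exact div_le_div_of_nonneg_right (hR.bound_F x) c.μG_pos.le

/-- Strong monotonicity of `∇₁G(·, x')` between the two minimizers, combined with the Lipschitz
bound in `x` alone. -/
theorem norm_zStar_sub_le (x x' : E d) :
    ‖zStar G x' - zStar G x‖ ≤ c.LG1 / c.μG * ‖x' - x‖ := by
  set z := zStar G x
  set z' := zStar G x'
  have h1 := hR.strongly_monotone x' z z'
  -- Both `∇₁G(z', x')` and `∇₁G(z, x)` vanish; exchanging them leaves a difference at the same `z`.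
  rw [hR.grad1_zStar x', ← hR.grad1_zStar x] at h1
  have h2 : ‖grad1 G z x - grad1 G z x'‖ ≤ c.LG1 * ‖x' - x‖ := by
    refine (norm_grad1_sub_le hR.diff_G hR.lip_G1 z z x' x).trans ?_
    rw [pt_sub_pt, sub_self, map_zero, zero_add, norm_inX_apply, norm_sub_rev]
  have h3 := h1.trans (real_inner_le_norm _ _)
  have h4 : c.μG * ‖z' - z‖ ^ 2 ≤ c.LG1 * ‖x' - x‖ * ‖z' - z‖ :=
    h3.trans (mul_le_mul_of_nonneg_right h2 (norm_nonneg _))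
  rw [div_mul_eq_mul_div, le_div_iff₀ c.μG_pos]
  rcases (norm_nonneg (z' - z)).eq_or_lt with h0 | h0
  · rw [← h0, zero_mul]
    exact mul_nonneg c.LG1_pos.le (norm_nonneg _)
  · nlinarith

theorem norm_graph_sub_le (x x' : E d) :
    ‖pt (zStar G x') x' - pt (zStar G x) x‖ ≤ c.lipGraph * ‖x' - x‖ := by
  refine (norm_pt_sub_pt_le _ _ _ _).trans ?_
  have := hR.norm_zStar_sub_le x x'
  unfold Constants.lipGraph
  linarith

/-- Subtract the linear systems solved by `v^*(x)` and `v^*(x')`, keeping the Hessian at `x` on the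
left. -/
theorem norm_vStar_sub_le (x x' : E d) :
    ‖vStar F G x' - vStar F G x‖ ≤ c.lipV * ‖x' - x‖ := by
  set z := zStar G x
  set z' := zStar G x'
  set v := vStar F G x
  set v' := vStar F G x'
  have hy := hR.norm_graph_sub_le x x'
  have h1 : hess11 G z x (v' - v)
      = -(grad1 F z' x' - grad1 F z x) - (hess11 G z' x' v' - hess11 G z x v') := by
    rw [map_sub, hR.hess11_vStar x, hR.hess11_vStar x']
    abel
  have h2 := mul_norm_le_of_coercive (hR.hess11_coercive z x) (v' - v)
  have h3 := norm_grad1_sub_le hR.diff_F hR.lip_F1 z z' x x'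
  have h4 := norm_hess11_sub_apply_le hR.diff_G hR.diff_G1 hR.lip_G2 z z' x x' v'
  have h5 : ‖hess11 G z x (v' - v)‖
      ≤ c.LF1 * (c.lipGraph * ‖x' - x‖) + c.LG2 * (c.lipGraph * ‖x' - x‖) * c.boundV := by
    rw [h1]
    refine (norm_sub_le _ _).trans ?_
    rw [norm_neg]
    have := c.LF1_pos
    have := c.LG2_pos
    have := c.lipGraph_pos
    refine add_le_add (h3.trans ?_) (h4.trans ?_)
    · gcongr
    · gcongr
      exact hR.norm_vStar_le x'
  unfold Constants.lipV
  rw [div_mul_eq_mul_div, le_div_iff₀ c.μG_pos]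
  linarith

/-- The candidate `A` comes from differentiating `∇₁G(z^*(x), x) = 0`. Because `∇₁G` vanishes at
both graph points, the Hessian maps the remainder of `z^*` to minus the Taylor remainder of `∇₁G`.
-/
theorem exists_expansion_zStar (x : E d) : ∃ A : E d →L[ℝ] E p,
    (∀ u, hess11 G (zStar G x) x (A u)
      = -rieszZ p d (fderiv ℝ (fderiv ℝ (joint G)) (pt (zStar G x) x) (inX p d u))) ∧
    ∀ x', ‖zStar G x' - zStar G x - A (x' - x)‖ ≤ c.quadZ * ‖x' - x‖ ^ 2 := by
  set z := zStar G x with hz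
  set H := hess11 G z x with hH
  set D2 := fderiv ℝ (fderiv ℝ (joint G)) (pt z x) with hD2
  have hco := hR.hess11_coercive z x
  refine ⟨-(H.inverse ∘L rieszZ p d ∘L D2 ∘L inX p d), fun u => ?_, fun x' => ?_⟩
  · simp only [neg_apply, ContinuousLinearMap.comp_apply, map_neg]
    rw [apply_inverse_of_coercive c.μG_pos hco]
  set z' := zStar G x' with hz'
  set A := -(H.inverse ∘L rieszZ p d ∘L D2 ∘L inX p d) with hA
  have hHA : H (A (x' - x)) = -rieszZ p d (D2 (inX p d (x' - x))) := by
    simp only [hA, neg_apply, ContinuousLinearMap.comp_apply, map_neg]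
    rw [apply_inverse_of_coercive c.μG_pos hco]
  have hHz : H (z' - z) = rieszZ p d (D2 (inZ p d (z' - z))) := by
    rw [hH, hess11_eq hR.diff_G hR.diff_G1]; rfl
  have h0 : rieszZ p d (fderiv ℝ (joint G) (pt z x)) = 0 := by
    rw [← grad1_eq hR.diff_G]; exact hR.grad1_zStar x
  have h0' : rieszZ p d (fderiv ℝ (joint G) (pt z' x')) = 0 := by
    rw [← grad1_eq hR.diff_G]; exact hR.grad1_zStar x'
  have h1 : H (z' - z - A (x' - x)) = -rieszZ p d (fderiv ℝ (joint G) (pt z' x')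
      - fderiv ℝ (joint G) (pt z x) - D2 (pt z' x' - pt z x)) := by
    rw [map_sub, hHA, hHz, pt_sub_pt, map_sub (rieszZ p d), map_sub (rieszZ p d), h0, h0',
      map_add D2, map_add (rieszZ p d)]
    abel
  have h2 := mul_norm_le_of_coercive hco (z' - z - A (x' - x))
  have h3 := taylor_le_of_lipschitz_fderiv hR.diff_G1 hR.lip_G2 (pt z x) (pt z' x')
  have h4 : ‖H (z' - z - A (x' - x))‖ ≤ c.LG2 * (c.lipGraph * ‖x' - x‖) ^ 2 := by
    rw [h1, norm_neg]
    refine (norm_rieszZ_apply_le _).trans (h3.trans ?_)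
    have := c.LG2_pos
    have := hR.norm_graph_sub_le x x'
    gcongr
  unfold Constants.quadZ
  rw [div_mul_eq_mul_div, le_div_iff₀ c.μG_pos]
  linarith

theorem quadraticallyApproximable_zStar :
    QuadraticallyApproximable (zStar G) c.Lstar c.quadZ :=
  .of_exists
    (fun x x' => (hR.norm_zStar_sub_le x x').trans
      (mul_le_mul_of_nonneg_right c.lipZ_le_Lstar (norm_nonneg _)))
    fun x => (hR.exists_expansion_zStar x).imp fun _ h => h.2

theorem hess11_fderiv_zStar (x u : E d) :
    hess11 G (zStar G x) x (fderiv ℝ (zStar G) x u)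
      = -rieszZ p d (fderiv ℝ (fderiv ℝ (joint G)) (pt (zStar G x) x) (inX p d u)) := by
  obtain ⟨A, hA, hA'⟩ := hR.exists_expansion_zStar x
  rw [(hasFDerivAt_of_quadratic hA').fderiv]
  exact hA u

end RegularPair

end Landscape

end SOBA

namespace SOBA

/-! ### Regularity of `v^*` and `h`, and properties of the mean directions. -/

noncomputable section Landscape

open scoped InnerProductSpace

set_option maxSynthPendingDepth 3

variable {p d : ℕ}

namespace RegularPair

variable {c : Constants} {F G : E p → E d → ℝ} (hR : RegularPair c F G)
include hR

/-- The system `∇²₁₁G v^* = -∇₁F` is differentiated along the graph of `z^*`. The remainder collects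
the Taylor remainders of `∇₁F` and of `∇²₁₁G v`, a product of two Lipschitz increments, and the
expansion error of `z^*`; each is quadratic. -/
theorem exists_expansion_vStar (x : E d) : ∃ A : E d →L[ℝ] E p,
    ∀ x', ‖vStar F G x' - vStar F G x - A (x' - x)‖ ≤ c.quadV * ‖x' - x‖ ^ 2 := by
  set z := zStar G x
  set v := vStar F G x
  set H := hess11 G z x with hH
  -- `Q` is the joint derivative of `∇₁F`; `S` below is that of `∇²₁₁G v` with `v` frozen.
  set Q : WithLp 2 (E p × E d) →L[ℝ] E p := rieszZ p d ∘L fderiv ℝ (fderiv ℝ (joint F)) (pt z x)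
    with hQ
  set D3 := fderiv ℝ (fderiv ℝ (fderiv ℝ (joint G))) (pt z x) with hD3
  set S : WithLp 2 (E p × E d) →L[ℝ] E p :=
    rieszZ p d ∘L ContinuousLinearMap.apply ℝ _ (inZ p d v) ∘L D3 with hS
  set Az := fderiv ℝ (zStar G) x with hAz
  have hco := hR.hess11_coercive z x
  refine ⟨-(H.inverse ∘L (Q + S) ∘L (inZ p d ∘L Az + inX p d)), fun x' => ?_⟩
  set A := -(H.inverse ∘L (Q + S) ∘L (inZ p d ∘L Az + inX p d)) with hA
  set z' := zStar G x'
  set v' := vStar F G x'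
  set r := z' - z - Az (x' - x) with hr
  have hHA : H (A (x' - x)) = -(Q + S) (inZ p d (Az (x' - x)) + inX p d (x' - x)) := by
    simp only [hA, neg_apply, ContinuousLinearMap.comp_apply, map_neg]
    rw [apply_inverse_of_coercive c.μG_pos hco]
    rfl
  have hw : inZ p d (Az (x' - x)) + inX p d (x' - x) = pt z' x' - pt z x - inZ p d r := by
    rw [pt_sub_pt, hr, map_sub (inZ p d) (z' - z)]; abel
  have h1 : H (v' - v - A (x' - x)) =
      -(grad1 F z' x' - grad1 F z x - Q (pt z' x' - pt z x))
      - (hess11 G z' x' v - H v - S (pt z' x' - pt z x))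
      - (hess11 G z' x' (v' - v) - H (v' - v)) - (Q (inZ p d r) + S (inZ p d r)) := by
    rw [map_sub H, map_sub H, hHA, hw, map_sub (Q + S), hR.hess11_vStar x, map_sub (hess11 G z' x'),
      hR.hess11_vStar x', add_apply, add_apply]
    abel
  set s := c.lipGraph * ‖x' - x‖ with hs
  have hs0 : 0 ≤ s := mul_nonneg c.lipGraph_pos.le (norm_nonneg _)
  have hy : ‖pt z' x' - pt z x‖ ≤ s := hR.norm_graph_sub_le x x'
  have hv : ‖v‖ ≤ c.boundV := hR.norm_vStar_le x
  have hdv : ‖v' - v‖ ≤ c.lipV * ‖x' - x‖ := hR.norm_vStar_sub_le x x'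
  have hrn : ‖r‖ ≤ c.quadZ * ‖x' - x‖ ^ 2 := hR.quadraticallyApproximable_zStar.expansion x x'
  have := c.LF1_pos
  have := c.LF2_pos
  have := c.LG2_pos
  have := c.LG3_pos
  have := c.boundV_pos
  have := c.quadZ_pos
  have e1 : ‖grad1 F z' x' - grad1 F z x - Q (pt z' x' - pt z x)‖ ≤ c.LF2 * s ^ 2 := by
    have h := taylor_le_of_lipschitz_fderiv hR.diff_F1 hR.lip_F2 (pt z x) (pt z' x')
    rw [grad1_eq hR.diff_F, grad1_eq hR.diff_F, hQ, ContinuousLinearMap.comp_apply, ← map_sub,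
      ← map_sub]
    refine (norm_rieszZ_apply_le _).trans (h.trans ?_)
    gcongr
  have e2 : ‖hess11 G z' x' v - H v - S (pt z' x' - pt z x)‖ ≤ c.LG3 * s ^ 2 * c.boundV := by
    have h := taylor_le_of_lipschitz_fderiv hR.diff_G2 hR.lip_G3 (pt z x) (pt z' x')
    have h2 : hess11 G z' x' v - H v - S (pt z' x' - pt z x) =
        rieszZ p d ((fderiv ℝ (fderiv ℝ (joint G)) (pt z' x')
          - fderiv ℝ (fderiv ℝ (joint G)) (pt z x) - D3 (pt z' x' - pt z x)) (inZ p d v)) := by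
      rw [hH, hess11_eq hR.diff_G hR.diff_G1, hess11_eq hR.diff_G hR.diff_G1, sub_apply, sub_apply,
        map_sub (rieszZ p d), map_sub (rieszZ p d)]
      rfl
    rw [h2]
    refine (norm_rieszZ_apply_le _).trans ((ContinuousLinearMap.le_of_opNorm_le _ h _).trans ?_)
    rw [norm_inZ_apply]
    gcongr
  have e3 : ‖hess11 G z' x' (v' - v) - H (v' - v)‖ ≤ c.LG2 * s * (c.lipV * ‖x' - x‖) := by
    refine (norm_hess11_sub_apply_le hR.diff_G hR.diff_G1 hR.lip_G2 z z' x x' (v' - v)).trans ?_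
    gcongr
  have e4 : ‖Q (inZ p d r)‖ ≤ c.LF1 * (c.quadZ * ‖x' - x‖ ^ 2) := by
    refine (norm_rieszZ_apply_le _).trans ?_
    refine (ContinuousLinearMap.le_of_opNorm_le _ (hR.norm_fderiv2_F_le _) _).trans ?_
    rw [norm_inZ_apply]
    gcongr
  have e5 : ‖S (inZ p d r)‖ ≤ c.LG2 * (c.quadZ * ‖x' - x‖ ^ 2) * c.boundV := by
    refine (norm_rieszZ_apply_le _).trans ?_
    have h := ContinuousLinearMap.le_of_opNorm_le _ (hR.norm_fderiv3_G_le (pt z x)) (inZ p d r)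
    refine (ContinuousLinearMap.le_of_opNorm_le _ h _).trans ?_
    rw [norm_inZ_apply, norm_inZ_apply]
    gcongr
  have h2 := mul_norm_le_of_coercive hco (v' - v - A (x' - x))
  rw [h1] at h2
  have h3 : ∀ a b e f g : E p, ‖-a - b - e - (f + g)‖ ≤ ‖a‖ + ‖b‖ + ‖e‖ + (‖f‖ + ‖g‖) := by
    intro a b e f g
    have i1 := norm_sub_le (-a - b - e) (f + g)
    have i2 := norm_sub_le (-a - b) e
    have i3 := norm_sub_le (-a) b
    have i4 := norm_add_le f g
    rw [norm_neg] at i3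
    linarith
  have h4 := h2.trans ((h3 _ _ _ _ _).trans
    (add_le_add (add_le_add (add_le_add e1 e2) e3) (add_le_add e4 e5)))
  unfold Constants.quadV
  rw [div_mul_eq_mul_div, le_div_iff₀ c.μG_pos, mul_comm]
  refine h4.trans (le_of_eq ?_)
  rw [hs]
  ring

theorem quadraticallyApproximable_vStar :
    QuadraticallyApproximable (vStar F G) c.Lstar c.quadV :=
  .of_exists
    (fun x x' => (hR.norm_vStar_sub_le x x').trans
      (mul_le_mul_of_nonneg_right c.lipV_le_Lstar (norm_nonneg _)))
    hR.exists_expansion_vStar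

/-- Adjoint computation: the chain rule leaves `∇₁F` paired with the derivative of `z^*`. Writing
`∇₁F = -∇²₁₁G v^*` and using the symmetry of the Hessian of `G`, the equation for that derivative
turns the pairing into `∇²₂₁G v^*`. -/
theorem hasGradientAt_value (x : E d) :
    HasGradientAt (value F G) (dirX F G (zStar G x, vStar F G x, x)) x := by
  set z := zStar G x with hz
  set v := vStar F G x with hv
  set D2 := fderiv ℝ (fderiv ℝ (joint G)) (pt z x) with hD2
  have hg : HasFDerivAt (fun x' => pt (zStar G x') x')
      (inZ p d ∘L fderiv ℝ (zStar G) x + inX p d) x := by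
    simp only [pt_eq]
    exact ((inZ p d).hasFDerivAt.comp x
      (hR.quadraticallyApproximable_zStar.differentiable x).hasFDerivAt).add
      (inX p d).hasFDerivAt
  have hF := HasFDerivAt.comp (g := joint F) (f := fun x' => pt (zStar G x') x') x
    (hR.diff_F (pt (zStar G x) x)).hasFDerivAt hg
  rw [hasGradientAt_iff_hasFDerivAt]
  refine hF.congr_fderiv ?_
  ext u
  set a := fderiv ℝ (zStar G) x u with ha
  have h1 : fderiv ℝ (joint F) (pt z x) (inZ p d a) = -D2 (inZ p d v) (inZ p d a) := by
    rw [← inner_rieszZ, ← grad1_eq hR.diff_F, ← neg_neg (grad1 F z x), ← hR.hess11_vStar x,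
      hess11_eq hR.diff_G hR.diff_G1, inner_neg_left]
    simp only [ContinuousLinearMap.comp_apply]
    rw [inner_rieszZ]
  have h2 : D2 (inZ p d a) (inZ p d v) = -D2 (inX p d u) (inZ p d v) := by
    have h := hR.hess11_fderiv_zStar x u
    rw [hess11_eq hR.diff_G hR.diff_G1] at h
    have h' := congrArg (fun w => ⟪w, v⟫_ℝ) h
    simp only [ContinuousLinearMap.comp_apply, inner_neg_left] at h'
    rw [inner_rieszZ, inner_rieszZ] at h'
    exact h'
  have h3 : ⟪dirX F G (z, v, x), u⟫_ℝ
      = D2 (inZ p d v) (inX p d u) + fderiv ℝ (joint F) (pt z x) (inX p d u) := by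
    rw [dirX, inner_add_left, hess21_eq hR.diff_G hR.diff_G1, grad2_eq hR.diff_F, inner_rieszX]
    simp only [ContinuousLinearMap.comp_apply]
    rw [inner_rieszX]
  rw [InnerProductSpace.toDual_apply_apply, h3]
  simp only [ContinuousLinearMap.comp_apply, add_apply, map_add]
  rw [← ha, ← hz, h1, hR.symm_G, ← hD2, h2, hR.symm_G (pt z x) (inX p d u)]
  ring

theorem differentiable_value : Differentiable ℝ (value F G) :=
  fun x => (hR.hasGradientAt_value x).differentiableAt

theorem gradient_value (x : E d) :
    gradient (value F G) x = dirX F G (zStar G x, vStar F G x, x) :=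
  (hR.hasGradientAt_value x).gradient

theorem norm_gradient_value_sub_le (x x' : E d) :
    ‖gradient (value F G) x' - gradient (value F G) x‖ ≤ c.lipGradH * ‖x' - x‖ := by
  rw [hR.gradient_value, hR.gradient_value]
  set z := zStar G x
  set z' := zStar G x'
  set v := vStar F G x
  set v' := vStar F G x'
  have hy : ‖pt z' x' - pt z x‖ ≤ c.lipGraph * ‖x' - x‖ := hR.norm_graph_sub_le x x'
  have h1 : dirX F G (z', v', x') - dirX F G (z, v, x)
      = (hess21 G z' x' v' - hess21 G z x v') + hess21 G z x (v' - v)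
        + (grad2 F z' x' - grad2 F z x) := by
    simp only [dirX, map_sub]; abel
  have := c.LG1_pos
  have := c.LF1_pos
  have := c.LG2_pos
  have := c.lipGraph_pos
  have e1 : ‖hess21 G z' x' v' - hess21 G z x v'‖
      ≤ c.LG2 * (c.lipGraph * ‖x' - x‖) * c.boundV := by
    refine (norm_hess21_sub_apply_le hR.diff_G hR.diff_G1 hR.lip_G2 z z' x x' v').trans ?_
    gcongr
    exact hR.norm_vStar_le x'
  have e2 : ‖hess21 G z x (v' - v)‖ ≤ c.LG1 * (c.lipV * ‖x' - x‖) := by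
    refine (norm_hess21_apply_le hR.diff_G hR.diff_G1 hR.norm_fderiv2_G_le z x (v' - v)).trans ?_
    gcongr
    exact hR.norm_vStar_sub_le x x'
  have e3 : ‖grad2 F z' x' - grad2 F z x‖ ≤ c.LF1 * (c.lipGraph * ‖x' - x‖) := by
    refine (norm_grad2_sub_le hR.diff_F hR.lip_F1 z z' x x').trans ?_
    gcongr
  rw [h1]
  refine (norm_add₃_le).trans ?_
  unfold Constants.lipGradH
  linarith

theorem value_expansion (x x' : E d) :
    |value F G x' - value F G x - ⟪gradient (value F G) x, x' - x⟫_ℝ|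
      ≤ c.lipGradH * ‖x' - x‖ ^ 2 := by
  have h := taylor_le_of_lipschitz_fderiv hR.differentiable_value (L := c.lipGradH)
    (fun y y' => ?_) x x'
  · rw [inner_gradient_left]
    exact h
  · rw [← toDual_gradient, ← toDual_gradient, ← map_sub, LinearIsometryEquiv.norm_map]
    exact hR.norm_gradient_value_sub_le y' y

/-- Compare `inf h` with the value after a gradient step of length `1/(2L)`, the best one for a
remainder `L ‖·‖²`. This later controls the gradient at the last iterate. -/
theorem norm_gradient_value_sq_le (hb : BddBelow (Set.range (value F G))) (x : E d) :
    ‖gradient (value F G) x‖ ^ 2 ≤ 4 * c.lipGradH * (value F G x - ⨅ x, value F G x) := by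
  set g := gradient (value F G) x
  set L := c.lipGradH
  have hL : 0 < L := c.lipGradH_pos
  have h1 := le_of_abs_le (hR.value_expansion x (x - (2 * L)⁻¹ • g))
  have h2 := ciInf_le hb (x - (2 * L)⁻¹ • g)
  have h3 : x - (2 * L)⁻¹ • g - x = -((2 * L)⁻¹ • g) := by abel
  rw [h3, inner_neg_right, real_inner_smul_right, real_inner_self_eq_norm_sq, norm_neg, norm_smul,
    Real.norm_of_nonneg (by positivity), mul_pow] at h1
  have h4 : L * ((2 * L)⁻¹ ^ 2 * ‖g‖ ^ 2) = ‖g‖ ^ 2 / (4 * L) := by field_simp; ring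
  have h5 : (2 * L)⁻¹ * ‖g‖ ^ 2 = 2 * (‖g‖ ^ 2 / (4 * L)) := by field_simp; ring
  rw [h4, h5] at h1
  have h6 : ‖g‖ ^ 2 / (4 * L) ≤ value F G x - ⨅ x, value F G x := by linarith
  rw [div_le_iff₀ (by positivity)] at h6
  linarith

theorem inner_dirZ_ge (z v : E p) (x : E d) :
    c.μG * ‖z - zStar G x‖ ^ 2 ≤ ⟪z - zStar G x, dirZ G (z, v, x)⟫_ℝ := by
  have h := hR.strongly_monotone x (zStar G x) z
  rw [hR.grad1_zStar, sub_zero, real_inner_comm] at h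
  exact h

theorem norm_dirZ_le (z v : E p) (x : E d) :
    ‖dirZ G (z, v, x)‖ ≤ c.LG1 * ‖z - zStar G x‖ := by
  have h := norm_grad1_sub_le hR.diff_G hR.lip_G1 (zStar G x) z x x
  rw [hR.grad1_zStar, sub_zero, pt_sub_pt, sub_self, map_zero, add_zero, norm_inZ_apply] at h
  exact h

/-- `D_v` is affine in `v` with linear part `∇²₁₁G(z, x)`, and `D_v(z^*, v^*, x) = 0`; so `r` is the
change of `D_v(·, v^*, x)` from `z^*` to `z`, which is where `ω` comes from. -/
theorem dirV_eq (z v : E p) (x : E d) : ∃ r : E p,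
    dirV F G (z, v, x) = hess11 G z x (v - vStar F G x) + r ∧
      ‖r‖ ≤ c.omega * ‖z - zStar G x‖ := by
  refine ⟨(hess11 G z x (vStar F G x) - hess11 G (zStar G x) x (vStar F G x))
    + (grad1 F z x - grad1 F (zStar G x) x), ?_, ?_⟩
  · rw [hR.hess11_vStar x, map_sub]
    simp only [dirV]; abel
  · have h1 := norm_hess11_sub_apply_le hR.diff_G hR.diff_G1 hR.lip_G2 (zStar G x) z x x
      (vStar F G x)
    have h2 := norm_grad1_sub_le hR.diff_F hR.lip_F1 (zStar G x) z x x
    rw [pt_sub_pt, sub_self, map_zero, add_zero, norm_inZ_apply] at h1 h2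
    refine (norm_add_le _ _).trans ?_
    have h3 : c.LG2 * ‖z - zStar G x‖ * ‖vStar F G x‖
        ≤ c.LG2 * ‖z - zStar G x‖ * c.boundV :=
      mul_le_mul_of_nonneg_left (hR.norm_vStar_le x)
        (mul_nonneg c.LG2_pos.le (norm_nonneg _))
    rw [c.omega_eq]
    linarith

theorem inner_dirV_ge (z v : E p) (x : E d) :
    c.μG * ‖v - vStar F G x‖ ^ 2 - c.omega * ‖z - zStar G x‖ * ‖v - vStar F G x‖
      ≤ ⟪v - vStar F G x, dirV F G (z, v, x)⟫_ℝ := by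
  obtain ⟨r, hr, hrn⟩ := hR.dirV_eq z v x
  have h1 := hR.hess11_coercive z x (v - vStar F G x)
  rw [real_inner_comm] at h1
  have h2 := neg_le_of_abs_le (abs_real_inner_le_norm (v - vStar F G x) r)
  have h3 := mul_le_mul_of_nonneg_left hrn (norm_nonneg (v - vStar F G x))
  rw [hr, inner_add_right]
  linarith

theorem norm_dirV_le (z v : E p) (x : E d) :
    ‖dirV F G (z, v, x)‖ ≤ c.LG1 * ‖v - vStar F G x‖ + c.omega * ‖z - zStar G x‖ := by
  obtain ⟨r, hr, hrn⟩ := hR.dirV_eq z v x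
  rw [hr]
  exact (norm_add_le _ _).trans (add_le_add
    (norm_hess11_apply_le hR.diff_G hR.diff_G1 hR.norm_fderiv2_G_le _ _ _) hrn)

/-- As `∇h = D_x(z^*, v^*, x)`, this compares `D_x` at two points; the `√2` in `Lx` pays for
squaring a sum of two errors. -/
theorem norm_dirX_sub_gradient_sq_le (z v : E p) (x : E d) :
    ‖dirX F G (z, v, x) - gradient (value F G) x‖ ^ 2
      ≤ c.Lx ^ 2 * (‖z - zStar G x‖ ^ 2 + ‖v - vStar F G x‖ ^ 2) := by
  rw [hR.gradient_value]
  set z' := zStar G x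
  set v' := vStar F G x
  have h1 : dirX F G (z, v, x) - dirX F G (z', v', x)
      = ((hess21 G z x v' - hess21 G z' x v') + (grad2 F z x - grad2 F z' x))
        + hess21 G z x (v - v') := by
    simp only [dirX, map_sub]; abel
  have e1 := norm_hess21_sub_apply_le hR.diff_G hR.diff_G1 hR.lip_G2 z' z x x v'
  have e2 := norm_grad2_sub_le hR.diff_F hR.lip_F1 z' z x x
  have e3 := norm_hess21_apply_le hR.diff_G hR.diff_G1 hR.norm_fderiv2_G_le z x (v - v')
  rw [pt_sub_pt, sub_self, map_zero, add_zero, norm_inZ_apply] at e1 e2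
  have e4 : c.LG2 * ‖z - z'‖ * ‖v'‖ ≤ c.LG2 * ‖z - z'‖ * c.boundV :=
    mul_le_mul_of_nonneg_left (hR.norm_vStar_le x) (mul_nonneg c.LG2_pos.le (norm_nonneg _))
  have e5 : ‖dirX F G (z, v, x) - dirX F G (z', v', x)‖
      ≤ c.omega * ‖z - z'‖ + c.LG1 * ‖v - v'‖ := by
    rw [h1, c.omega_eq]
    refine (norm_add₃_le).trans ?_
    linarith
  set M := max c.omega c.LG1 with hM
  have hM1 : c.omega ≤ M := le_max_left _ _
  have hM2 : c.LG1 ≤ M := le_max_right _ _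
  have e6 : ‖dirX F G (z, v, x) - dirX F G (z', v', x)‖ ≤ M * (‖z - z'‖ + ‖v - v'‖) := by
    refine e5.trans ?_
    rw [mul_add]
    gcongr
  have e7 : c.Lx ^ 2 = 2 * M ^ 2 := by
    rw [Constants.Lx, mul_pow, Real.sq_sqrt (by norm_num)]
  rw [e7]
  calc _ ≤ (M * (‖z - z'‖ + ‖v - v'‖)) ^ 2 := by gcongr
    _ = M ^ 2 * (‖z - z'‖ + ‖v - v'‖) ^ 2 := by ring
    _ ≤ M ^ 2 * (2 * (‖z - z'‖ ^ 2 + ‖v - v'‖ ^ 2)) := by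
        gcongr
        nlinarith [sq_nonneg (‖z - z'‖ - ‖v - v'‖)]
    _ = _ := by ring

end RegularPair

end Landscape

end SOBA

namespace SOBA

/-! ### Independence of the draws and unbiasedness. -/

noncomputable section Sampling

variable {p d n m : ℕ}

theorem mean_smul_sum_sum {W : Type*} [AddCommGroup W] [Module ℝ W] (hn : n ≠ 0) (hm : m ≠ 0)
    (a : Fin n → W) (b : Fin m → W) :
    ((n : ℝ)⁻¹ • ∑ i, a i) + ((m : ℝ)⁻¹ • ∑ j, b j)
      = ((n : ℝ) * m)⁻¹ • ∑ i, ∑ j, (a i + b j) := by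
  have hn' : (n : ℝ) ≠ 0 := Nat.cast_ne_zero.2 hn
  have hm' : (m : ℝ) ≠ 0 := Nat.cast_ne_zero.2 hm
  simp only [Finset.sum_add_distrib, Finset.sum_const, Finset.card_univ, Fintype.card_fin,
    smul_add, ← Finset.smul_sum, ← Nat.cast_smul_eq_nsmul ℝ, smul_smul]
  congr 2 <;> field_simp

section Mean

variable {c : Constants} {F : Fin m → E p → E d → ℝ} {G : Fin n → E p → E d → ℝ}

/-- The sum over `j` is idle; it gives all three directions the same form, a mean over pairs. -/
theorem Regular.dirZ_mean (hR : Regular c F G) (hm : m ≠ 0) (y : E p × E p × E d) :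
    dirZ (mean G) y = ((n : ℝ) * m)⁻¹ • ∑ i, ∑ _j : Fin m, dirZ (G i) y := by
  have hm' : (m : ℝ) ≠ 0 := Nat.cast_ne_zero.2 hm
  simp only [dirZ, Finset.sum_const, Finset.card_univ, Fintype.card_fin,
    grad1_mean fun i => (hR.diff_Gi i).1, ← Finset.smul_sum, ← Nat.cast_smul_eq_nsmul ℝ, smul_smul]
  congr 1
  field_simp

theorem Regular.dirV_mean (hR : Regular c F G) (hn : n ≠ 0) (hm : m ≠ 0) (y : E p × E p × E d) :
    dirV (mean F) (mean G) y = ((n : ℝ) * m)⁻¹ • ∑ i, ∑ j, dirV (F j) (G i) y := by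
  simp only [dirV, grad1_mean hR.diff_Fj,
    hess11_mean_apply (fun i => (hR.diff_Gi i).1) fun i => (hR.diff_Gi i).2]
  exact mean_smul_sum_sum hn hm _ _

theorem Regular.dirX_mean (hR : Regular c F G) (hn : n ≠ 0) (hm : m ≠ 0) (y : E p × E p × E d) :
    dirX (mean F) (mean G) y = ((n : ℝ) * m)⁻¹ • ∑ i, ∑ j, dirX (F j) (G i) y := by
  simp only [dirX, grad2_mean hR.diff_Fj,
    hess21_mean_apply (fun i => (hR.diff_Gi i).1) fun i => (hR.diff_Gi i).2]
  exact mean_smul_sum_sum hn hm _ _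

end Mean

variable {F : Fin m → E p → E d → ℝ} {G : Fin n → E p → E d → ℝ} {ρ γ : ℝ}
  {y₀ : E p × E p × E d}

theorem iter_congr {I I' : ℕ → Fin n} {J J' : ℕ → Fin m} {t : ℕ}
    (hI : ∀ s < t, I s = I' s) (hJ : ∀ s < t, J s = J' s) :
    iter F G ρ γ y₀ I J t = iter F G ρ γ y₀ I' J' t := by
  induction t with
  | zero => rfl
  | succ t ih =>
    simp only [iter]
    rw [ih (fun s hs => hI s (hs.trans t.lt_succ_self)) fun s hs => hJ s (hs.trans t.lt_succ_self),
      hI t t.lt_succ_self, hJ t t.lt_succ_self]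

variable {Ω : Type*} {I : ℕ → Ω → Fin n} {J : ℕ → Ω → Fin m}

/-- The indices drawn before iteration `t`. -/
def path (I : ℕ → Ω → Fin n) (J : ℕ → Ω → Fin m) (t : ℕ) (ω : Ω) :
    Finset.range t → Fin n × Fin m := fun s => (I s ω, J s ω)

/-- A path takes finitely many values, so measurability and integrability of anything built from the
iterate become automatic. -/
theorem exists_iter_eq_path [Nonempty Ω] (F : Fin m → E p → E d → ℝ) (G : Fin n → E p → E d → ℝ)
    (ρ γ : ℝ) (y₀ : E p × E p × E d) (I : ℕ → Ω → Fin n) (J : ℕ → Ω → Fin m) (t : ℕ) :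
    ∃ Φ : (Finset.range t → Fin n × Fin m) → E p × E p × E d,
      ∀ ω, iter F G ρ γ y₀ (fun s => I s ω) (fun s => J s ω) t = Φ (path I J t ω) := by
  obtain ⟨ω₀⟩ := ‹Nonempty Ω›
  refine ⟨fun q => iter F G ρ γ y₀
    -- The default index is never read before iteration `t`; `ω₀` only serves to produce one.
    (fun s => if h : s ∈ Finset.range t then (q ⟨s, h⟩).1 else I 0 ω₀)
    (fun s => if h : s ∈ Finset.range t then (q ⟨s, h⟩).2 else J 0 ω₀) t, fun ω => ?_⟩
  refine iter_congr (fun s hs => ?_) fun s hs => ?_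
  · rw [dif_pos (Finset.mem_range.2 hs)]; rfl
  · rw [dif_pos (Finset.mem_range.2 hs)]; rfl

variable [MeasurableSpace Ω] {P : Measure Ω}

theorem UniformSampling.measurable_path (hS : UniformSampling P I J) (t : ℕ) :
    Measurable (path I J t) :=
  measurable_pi_lambda _ fun s => (hS.measurable_I s).prodMk (hS.measurable_J s)

theorem UniformSampling.indepFun_path (hS : UniformSampling P I J) (t : ℕ) :
    IndepFun (path I J t) (fun ω => (I t ω, J t ω)) P := by
  have h := hS.indep_time.indepFun_finset (Finset.range t) {t} (by simp)
    fun s => (hS.measurable_I s).prodMk (hS.measurable_J s)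
  exact h.comp (φ := id) (ψ := fun q => q ⟨t, Finset.mem_singleton_self t⟩) measurable_id
    (measurable_of_finite _)

theorem UniformSampling.measureReal_pair [IsProbabilityMeasure P] (hS : UniformSampling P I J)
    (t : ℕ) (i : Fin n) (j : Fin m) :
    P.real {ω | (I t ω, J t ω) = (i, j)} = ((n : ℝ) * m)⁻¹ := by
  have h := (hS.indep_IJ t).measure_inter_preimage_eq_mul {i} {j}
    (MeasurableSet.singleton i) (MeasurableSet.singleton j)
  have h1 : {ω | (I t ω, J t ω) = (i, j)} = I t ⁻¹' {i} ∩ J t ⁻¹' {j} := by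
    ext ω; simp [Prod.ext_iff]
  have h2 := hS.uniform_I t i
  have h3 := hS.uniform_J t j
  rw [h1, measureReal_def, h, ENNReal.toReal_mul, mul_inv]
  rw [measureReal_def] at h2 h3
  rw [one_div] at h2 h3
  exact congrArg₂ (· * ·) h2 h3

theorem UniformSampling.integrable_comp_path [IsProbabilityMeasure P] {W : Type*}
    [NormedAddCommGroup W] (hS : UniformSampling P I J) {t : ℕ}
    (Ψ : (Finset.range t → Fin n × Fin m) → W) : Integrable (fun ω => Ψ (path I J t ω)) P :=
  (Integrable.of_finite (μ := P.map (path I J t)) (f := Ψ)).comp_measurable (hS.measurable_path t)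

/-- Split according to the value of the current pair. Its indicator is independent of the path and
has expectation `1/(nm)`. -/
theorem UniformSampling.integral_path_pair [IsProbabilityMeasure P]
    (hS : UniformSampling P I J) {t : ℕ}
    (ψ : (Finset.range t → Fin n × Fin m) → Fin n → Fin m → ℝ) :
    ∫ ω, ψ (path I J t ω) (I t ω) (J t ω) ∂P
      = ∫ ω, ((n : ℝ) * m)⁻¹ • ∑ i, ∑ j, ψ (path I J t ω) i j ∂P := by
  classical
  set δ : Fin n → Fin m → Ω → ℝ := fun i j ω => if (I t ω, J t ω) = (i, j) then 1 else 0 with hδ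
  have hset (i : Fin n) (j : Fin m) : MeasurableSet {ω | (I t ω, J t ω) = (i, j)} :=
    ((hS.measurable_I t).prodMk (hS.measurable_J t)) (MeasurableSet.singleton (i, j))
  have hδi (i : Fin n) (j : Fin m) : δ i j = Set.indicator {ω | (I t ω, J t ω) = (i, j)} 1 := by
    ext ω; simp [hδ, Set.indicator_apply]
  have hδint (i : Fin n) (j : Fin m) : ∫ ω, δ i j ω ∂P = ((n : ℝ) * m)⁻¹ := by
    rw [hδi, integral_indicator_one (hset i j), hS.measureReal_pair]
  have hsplit (ω : Ω) : ψ (path I J t ω) (I t ω) (J t ω)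
      = ∑ i, ∑ j, ψ (path I J t ω) i j * δ i j ω := by
    rw [Finset.sum_eq_single (I t ω), Finset.sum_eq_single (J t ω)]
    · simp [hδ]
    · intro j _ hj; simp [hδ, hj.symm]
    · simp
    · intro i _ hi; simp [hδ, hi.symm]
    · simp
  have hδint' (i : Fin n) (j : Fin m) : Integrable (δ i j) P := by
    rw [hδi]; exact (integrable_const (1 : ℝ)).indicator (hset i j)
  have hind (i : Fin n) (j : Fin m) :
      IndepFun (fun ω => ψ (path I J t ω) i j) (δ i j) P :=
    (hS.indepFun_path t).comp (φ := fun q => ψ q i j)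
      (ψ := fun a => if a = (i, j) then (1 : ℝ) else 0)
      (measurable_of_finite _) (measurable_of_finite _)
  have hint (i : Fin n) (j : Fin m) : Integrable (fun ω => ψ (path I J t ω) i j) P :=
    hS.integrable_comp_path fun q => ψ q i j
  have hprod (i : Fin n) (j : Fin m) :
      Integrable (fun ω => ψ (path I J t ω) i j * δ i j ω) P :=
    (hind i j).integrable_mul (hint i j) (hδint' i j)
  simp only [hsplit, smul_eq_mul]
  rw [integral_const_mul, integral_finsetSum _ fun i _ => integrable_finsetSum _ fun j _ => hprod i j,
    integral_finsetSum _ fun i _ => integrable_finsetSum _ fun j _ => hint i j, Finset.mul_sum]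
  refine Finset.sum_congr rfl fun i _ => ?_
  rw [integral_finsetSum _ fun j _ => hprod i j, integral_finsetSum _ fun j _ => hint i j,
    Finset.mul_sum]
  refine Finset.sum_congr rfl fun j _ => ?_
  rw [(hind i j).integral_fun_mul_eq_mul_integral (hint i j).aestronglyMeasurable
    (hδint' i j).aestronglyMeasurable, hδint, mul_comm]

/-- The weight is a function of `Y`, so it can be pulled into the conditional expectation. Weights
are needed because the tracking expansion contains a second moment multiplied by the current error.
-/
theorem integral_mul_le_of_condExp_le [IsProbabilityMeasure P] {B : Type*} [mB : MeasurableSpace B]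
    {Y : Ω → B} (hY : Measurable Y) {X b : Ω → ℝ} {w : B → ℝ} (hX : Integrable X P)
    (hw : Measurable w) (hw0 : ∀ y, 0 ≤ w y) (hwX : Integrable (fun ω => w (Y ω) * X ω) P)
    (hwb : Integrable (fun ω => w (Y ω) * b ω) P)
    (h : P[X | MeasurableSpace.comap Y mB] ≤ᵐ[P] b) :
    ∫ ω, w (Y ω) * X ω ∂P ≤ ∫ ω, w (Y ω) * b ω ∂P := by
  have hm : MeasurableSpace.comap Y mB ≤ ‹MeasurableSpace Ω› := hY.comap_le
  have h1 : P[(fun ω => w (Y ω)) * X | MeasurableSpace.comap Y mB]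
      =ᵐ[P] (fun ω => w (Y ω)) * P[X | MeasurableSpace.comap Y mB] :=
    condExp_mul_of_stronglyMeasurable_left
      (hw.comp (comap_measurable Y)).stronglyMeasurable hwX hX
  have h2 : ∫ ω, w (Y ω) * X ω ∂P
      = ∫ ω, (P[(fun ω => w (Y ω)) * X | MeasurableSpace.comap Y mB]) ω ∂P :=
    (integral_condExp hm).symm
  rw [h2]
  refine integral_mono_ae integrable_condExp hwb ?_
  filter_upwards [h1, h] with ω h3 h4
  rw [h3]
  exact mul_le_mul_of_nonneg_left h4 (hw0 _)

end Sampling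

end SOBA

namespace SOBA

/-! ### One-step tracking bounds, summation, and the drift inequality. -/

noncomputable section Step

open scoped InnerProductSpace

/-- The motion of the target is kept to first order as `fderiv ℝ ζ x e`, linear in `e`, so that
averaging replaces `e` by its mean; a Lipschitz bound alone would leave noise of order `γ`. -/
theorem tracking_sq_le {V X : Type*} [NormedAddCommGroup V] [InnerProductSpace ℝ V]
    [NormedAddCommGroup X] [NormedSpace ℝ X] {ζ : X → V} {L K : ℝ}
    (h : QuadraticallyApproximable ζ L K) (w D : V) (x e : X) (ρ γ : ℝ) :
    ‖w - ρ • D - ζ (x - γ • e)‖ ^ 2 ≤ ‖w - ζ x‖ ^ 2 - 2 * ρ * ⟪w - ζ x, D⟫_ℝ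
      + 2 * γ * ⟪w - ζ x, fderiv ℝ ζ x e⟫_ℝ + 2 * K * γ ^ 2 * (‖w - ζ x‖ * ‖e‖ ^ 2)
      + 2 * ρ ^ 2 * ‖D‖ ^ 2 + 2 * L ^ 2 * γ ^ 2 * ‖e‖ ^ 2 := by
  set u := w - ζ x with hu
  set q := ζ (x - γ • e) - ζ x with hq
  have hxe : x - γ • e - x = -(γ • e) := by abel
  have hsq : ‖γ • e‖ ^ 2 = γ ^ 2 * ‖e‖ ^ 2 := by
    rw [norm_smul, mul_pow, Real.norm_eq_abs, sq_abs]
  have h1 := h.expansion x (x - γ • e)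
  have h2 := h.lipschitz x (x - γ • e)
  rw [hxe, norm_neg] at h1 h2
  rw [hsq, map_neg, map_smul, sub_neg_eq_add, ← hq] at h1
  rw [← hq] at h2
  have h3 : w - ρ • D - ζ (x - γ • e) = u - (ρ • D + q) := by rw [hu, hq]; abel
  have h4 := neg_le_of_abs_le (abs_real_inner_le_norm u (q + γ • fderiv ℝ ζ x e))
  rw [inner_add_right, real_inner_smul_right] at h4
  have h5 := mul_le_mul_of_nonneg_left h1 (norm_nonneg u)
  have h6 : ‖q‖ ^ 2 ≤ L ^ 2 * (γ ^ 2 * ‖e‖ ^ 2) := by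
    rw [← hsq, ← mul_pow]; gcongr
  have h7 : ‖ρ • D + q‖ ^ 2 ≤ 2 * (ρ ^ 2 * ‖D‖ ^ 2) + 2 * ‖q‖ ^ 2 := by
    have i1 := norm_add_le (ρ • D) q
    have i2 : ‖ρ • D‖ ^ 2 = ρ ^ 2 * ‖D‖ ^ 2 := by
      rw [norm_smul, mul_pow, Real.norm_eq_abs, sq_abs]
    rw [← i2]
    have i3 : ‖ρ • D + q‖ ^ 2 ≤ (‖ρ • D‖ + ‖q‖) ^ 2 := by gcongr
    nlinarith [sq_nonneg (‖ρ • D‖ - ‖q‖)]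
  rw [h3, norm_sub_sq_real, inner_add_right, real_inner_smul_right]
  linarith

variable {p d n m : ℕ} {Ω : Type*} {I : ℕ → Ω → Fin n} {J : ℕ → Ω → Fin m}

/-- `Y` is a function of the indices drawn before iteration `t`. -/
def Predictable {B : Type*} (I : ℕ → Ω → Fin n) (J : ℕ → Ω → Fin m) (t : ℕ) (Y : Ω → B) : Prop :=
  ∃ Φ : (Finset.range t → Fin n × Fin m) → B, ∀ ω, Y ω = Φ (path I J t ω)

section Predictable

variable [MeasurableSpace Ω] {P : Measure Ω} [IsProbabilityMeasure P]
  {B W : Type*} [NormedAddCommGroup W] {t : ℕ} {Y : Ω → B}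

omit [IsProbabilityMeasure P] in
theorem Predictable.measurable [MeasurableSpace B] (hY : Predictable I J t Y)
    (hS : UniformSampling P I J) : Measurable Y := by
  obtain ⟨Φ, hΦ⟩ := hY
  rw [funext hΦ]
  exact (measurable_of_finite Φ).comp (hS.measurable_path t)

theorem Predictable.integrable (hY : Predictable I J t Y) (hS : UniformSampling P I J)
    (f : B → W) : Integrable (fun ω => f (Y ω)) P := by
  obtain ⟨Φ, hΦ⟩ := hY
  simp only [hΦ]
  exact hS.integrable_comp_path fun q => f (Φ q)

theorem Predictable.integrable_draw (hY : Predictable I J t Y) (hS : UniformSampling P I J)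
    (f : B → Fin n → Fin m → W) : Integrable (fun ω => f (Y ω) (I t ω) (J t ω)) P := by
  obtain ⟨Φ, hΦ⟩ := hY
  simp only [hΦ]
  exact (Integrable.of_finite (μ := P.map fun ω => (path I J t ω, I t ω, J t ω))
    (f := fun q => f (Φ q.1) q.2.1 q.2.2)).comp_measurable
    ((hS.measurable_path t).prodMk ((hS.measurable_I t).prodMk (hS.measurable_J t)))

theorem Predictable.integral_draw (hY : Predictable I J t Y) (hS : UniformSampling P I J)
    (f : B → Fin n → Fin m → ℝ) : ∫ ω, f (Y ω) (I t ω) (J t ω) ∂P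
      = ∫ ω, ((n : ℝ) * m)⁻¹ • ∑ i, ∑ j, f (Y ω) i j ∂P := by
  obtain ⟨Φ, hΦ⟩ := hY
  simp only [hΦ]
  exact hS.integral_path_pair fun q => f (Φ q)

theorem Predictable.integral_inner_draw {V : Type*} [NormedAddCommGroup V] [InnerProductSpace ℝ V]
    (hY : Predictable I J t Y) (hS : UniformSampling P I J) (U : B → V)
    {D : B → Fin n → Fin m → V} {D' : B → V}
    (hD : ∀ y, D' y = ((n : ℝ) * m)⁻¹ • ∑ i, ∑ j, D y i j) :
    ∫ ω, ⟪U (Y ω), D (Y ω) (I t ω) (J t ω)⟫_ℝ ∂P = ∫ ω, ⟪U (Y ω), D' (Y ω)⟫_ℝ ∂P := by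
  rw [hY.integral_draw hS fun y i j => ⟪U y, D y i j⟫_ℝ]
  simp only [hD, inner_smul_right, inner_sum, smul_eq_mul]

/-- Expectation of `tracking_sq_le`: unbiasedness handles the two inner products, the conditional
moment bounds handle the squares. -/
theorem Predictable.integral_tracking_le {k : ℕ} {Y : Ω → E p × E p × E d}
    (hY : Predictable I J t Y) (hS : UniformSampling P I J)
    {ζ : E d → E k} {L K Bx ρ γ : ℝ} (hζ : QuadraticallyApproximable ζ L K) (hK : 0 ≤ K)
    {w : E p × E p × E d → E k} (hw : Continuous w)
    {Dw : E p × E p × E d → Fin n → Fin m → E k} {Dw' : E p × E p × E d → E k}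
    (hDw : ∀ y, Dw' y = ((n : ℝ) * m)⁻¹ • ∑ i, ∑ j, Dw y i j)
    {Dx : E p × E p × E d → Fin n → Fin m → E d} {Dx' : E p × E p × E d → E d}
    (hDx : ∀ y, Dx' y = ((n : ℝ) * m)⁻¹ • ∑ i, ∑ j, Dx y i j)
    {M : E p × E p × E d → ℝ}
    (hM : P[fun ω => ‖Dw (Y ω) (I t ω) (J t ω)‖ ^ 2 | MeasurableSpace.comap Y inferInstance]
      ≤ᵐ[P] fun ω => M (Y ω))
    (hB : P[fun ω => ‖Dx (Y ω) (I t ω) (J t ω)‖ ^ 2 | MeasurableSpace.comap Y inferInstance]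
      ≤ᵐ[P] fun _ => Bx ^ 2) :
    ∫ ω, ‖w (Y ω) - ρ • Dw (Y ω) (I t ω) (J t ω)
        - ζ ((Y ω).2.2 - γ • Dx (Y ω) (I t ω) (J t ω))‖ ^ 2 ∂P
      ≤ ∫ ω, (‖w (Y ω) - ζ (Y ω).2.2‖ ^ 2 - 2 * ρ * ⟪w (Y ω) - ζ (Y ω).2.2, Dw' (Y ω)⟫_ℝ
        + 2 * γ * ⟪w (Y ω) - ζ (Y ω).2.2, fderiv ℝ ζ (Y ω).2.2 (Dx' (Y ω))⟫_ℝ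
        + K * γ ^ 2 * Bx ^ 2 * (1 + ‖w (Y ω) - ζ (Y ω).2.2‖ ^ 2)
        + 2 * ρ ^ 2 * M (Y ω) + 2 * L ^ 2 * γ ^ 2 * Bx ^ 2) ∂P := by
  set U : E p × E p × E d → E k := fun y => w y - ζ y.2.2 with hU
  have hUc : Continuous U := hw.sub (hζ.continuous.comp continuous_snd.snd)
  have hYm := hY.measurable hS
  have m1 := integral_mul_le_of_condExp_le hYm (w := fun _ => (1 : ℝ))
    (hY.integrable_draw hS fun y i j => ‖Dw y i j‖ ^ 2) measurable_const (fun _ => zero_le_one)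
    (hY.integrable_draw hS fun y i j => 1 * ‖Dw y i j‖ ^ 2) (hY.integrable hS fun y => 1 * M y) hM
  have m2 := integral_mul_le_of_condExp_le hYm (w := fun _ => (1 : ℝ))
    (hY.integrable_draw hS fun y i j => ‖Dx y i j‖ ^ 2) measurable_const (fun _ => zero_le_one)
    (hY.integrable_draw hS fun y i j => 1 * ‖Dx y i j‖ ^ 2)
    (hY.integrable hS fun _ => 1 * Bx ^ 2) hB
  have m3 := integral_mul_le_of_condExp_le hYm (w := fun y => ‖U y‖)
    (hY.integrable_draw hS fun y i j => ‖Dx y i j‖ ^ 2) hUc.norm.measurable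
    (fun _ => norm_nonneg _) (hY.integrable_draw hS fun y i j => ‖U y‖ * ‖Dx y i j‖ ^ 2)
    (hY.integrable hS fun y => ‖U y‖ * Bx ^ 2) hB
  simp only [one_mul] at m1 m2
  -- `2‖U‖ ≤ 1 + ‖U‖²` converts the linear weight into a quantity controlled by the Lyapunov
  -- function.
  have m4 : ∫ ω, ‖U (Y ω)‖ * Bx ^ 2 ∂P ≤ ∫ ω, Bx ^ 2 * (1 + ‖U (Y ω)‖ ^ 2) / 2 ∂P := by
    refine integral_mono (hY.integrable hS fun y => ‖U y‖ * Bx ^ 2)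
      (hY.integrable hS fun y => Bx ^ 2 * (1 + ‖U y‖ ^ 2) / 2) fun ω => ?_
    nlinarith [mul_nonneg (sq_nonneg Bx) (sq_nonneg (‖U (Y ω)‖ - 1))]
  have i1 := hY.integral_inner_draw hS U hDw
  -- The derivative of `ζ` is linear and evaluated at a point determined by `Y`, so it preserves
  -- unbiasedness.
  have i2 : ∫ ω, ⟪U (Y ω), fderiv ℝ ζ (Y ω).2.2 (Dx (Y ω) (I t ω) (J t ω))⟫_ℝ ∂P
      = ∫ ω, ⟪U (Y ω), fderiv ℝ ζ (Y ω).2.2 (Dx' (Y ω))⟫_ℝ ∂P :=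
    hY.integral_inner_draw hS U (D := fun y i j => fderiv ℝ ζ y.2.2 (Dx y i j))
      (D' := fun y => fderiv ℝ ζ y.2.2 (Dx' y)) fun y => by simp only [hDx, map_smul, map_sum]
  have f0 := hY.integrable hS fun y => ‖U y‖ ^ 2
  have f1 := (hY.integrable_draw hS fun y i j => ⟪U y, Dw y i j⟫_ℝ).const_mul (2 * ρ)
  have f2 := (hY.integrable_draw hS
    fun y i j => ⟪U y, fderiv ℝ ζ y.2.2 (Dx y i j)⟫_ℝ).const_mul (2 * γ)
  have f3 := (hY.integrable_draw hS fun y i j => ‖U y‖ * ‖Dx y i j‖ ^ 2).const_mul (2 * K * γ ^ 2)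
  have f4 := (hY.integrable_draw hS fun y i j => ‖Dw y i j‖ ^ 2).const_mul (2 * ρ ^ 2)
  have f5 := (hY.integrable_draw hS fun y i j => ‖Dx y i j‖ ^ 2).const_mul (2 * L ^ 2 * γ ^ 2)
  have e1 := (hY.integrable hS fun y => ⟪U y, Dw' y⟫_ℝ).const_mul (2 * ρ)
  have e2 := (hY.integrable hS fun y => ⟪U y, fderiv ℝ ζ y.2.2 (Dx' y)⟫_ℝ).const_mul (2 * γ)
  have e3 := (hY.integrable hS fun y => (1 + ‖U y‖ ^ 2)).const_mul (K * γ ^ 2 * Bx ^ 2)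
  have e4 := (hY.integrable hS M).const_mul (2 * ρ ^ 2)
  have e5 : Integrable (fun _ : Ω => 2 * L ^ 2 * γ ^ 2 * Bx ^ 2) P := integrable_const _
  refine (integral_mono (hY.integrable_draw hS
      fun y i j => ‖w y - ρ • Dw y i j - ζ (y.2.2 - γ • Dx y i j)‖ ^ 2)
    (((((f0.sub f1).add f2).add f3).add f4).add f5)
    fun ω => tracking_sq_le hζ (w (Y ω)) (Dw (Y ω) (I t ω) (J t ω)) (Y ω).2.2
      (Dx (Y ω) (I t ω) (J t ω)) ρ γ).trans ?_
  rw [integral_add' ((((f0.sub f1).add f2).add f3).add f4) f5,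
    integral_add' (((f0.sub f1).add f2).add f3) f4, integral_add' ((f0.sub f1).add f2) f3,
    integral_add' (f0.sub f1) f2, integral_sub' f0 f1]
  have hrhs := integral_add' ((((f0.sub e1).add e2).add e3).add e4) e5
  rw [integral_add' (((f0.sub e1).add e2).add e3) e4, integral_add' ((f0.sub e1).add e2) e3,
    integral_add' (f0.sub e1) e2, integral_sub' f0 e1] at hrhs
  refine le_trans ?_ (le_of_eq hrhs.symm)
  simp only [integral_const_mul, integral_const, probReal_univ, one_smul] at m2 ⊢
  rw [i1, i2]
  rw [integral_div, integral_const_mul] at m4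
  have a3 := mul_le_mul_of_nonneg_left (m3.trans m4)
    (show 0 ≤ 2 * K * γ ^ 2 by positivity)
  have a4 := mul_le_mul_of_nonneg_left m1 (show 0 ≤ 2 * ρ ^ 2 by positivity)
  have a5 := mul_le_mul_of_nonneg_left m2 (show 0 ≤ 2 * L ^ 2 * γ ^ 2 by positivity)
  linarith

end Predictable

/-- Dropping `g` gives a uniform bound on `S`, via `(1 + K₃ r)^t ≤ exp (K₃ R)`. Inserting it in the
step inequality makes the growth term additive, and the sum telescopes with `g` kept. It is used
with `r = ρ²`, for which `R` is free of `T`. -/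
theorem gronwall_sum_le {S g : ℕ → ℝ} {a r K₁ K₃ R S₀ : ℝ} {T : ℕ} (hS0 : ∀ t, 0 ≤ S t)
    (hg0 : ∀ t, 0 ≤ g t) (ha : 0 ≤ a) (hr : 0 ≤ r) (hK₁ : 0 ≤ K₁) (hK₃ : 0 ≤ K₃)
    (hR : r * T = R) (hinit : S 0 ≤ S₀)
    (hstep : ∀ t < T, S (t + 1) + a * g t ≤ (1 + K₃ * r) * S t + K₁ * r) :
    S T ≤ (S₀ + K₁ * R) * Real.exp (K₃ * R) ∧
      a * ∑ t ∈ Finset.range T, g t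
        ≤ S₀ + R * (K₁ + K₃ * ((S₀ + K₁ * R) * Real.exp (K₃ * R))) := by
  have hS₀ : 0 ≤ S₀ := (hS0 0).trans hinit
  set M := (S₀ + K₁ * R) * Real.exp (K₃ * R) with hM
  have hq : 1 ≤ 1 + K₃ * r := by nlinarith [mul_nonneg hK₃ hr]
  have hpow : ∀ t ≤ T, S t ≤ (S₀ + K₁ * r * t) * (1 + K₃ * r) ^ t := by
    intro t
    induction t with
    | zero => intro _; simpa using hinit
    | succ t ih =>
      intro ht
      have h1 := hstep t ht
      have h2 := ih (Nat.le_of_succ_le ht)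
      have h3 := mul_nonneg ha (hg0 t)
      have h4 := mul_le_mul_of_nonneg_left h2 (zero_le_one.trans hq)
      have h5 : 1 ≤ (1 + K₃ * r) ^ (t + 1) := one_le_pow₀ hq
      have h6 := mul_le_mul_of_nonneg_left h5 (mul_nonneg hK₁ hr)
      push_cast
      rw [pow_succ] at h6 ⊢
      nlinarith
  have hbound : ∀ t ≤ T, S t ≤ M := by
    intro t ht
    have htT : (t : ℝ) ≤ T := Nat.cast_le.2 ht
    refine (hpow t ht).trans ?_
    have h1 : (1 + K₃ * r) ^ t ≤ Real.exp (K₃ * R) := by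
      have h2 : 1 + K₃ * r ≤ Real.exp (K₃ * r) := by linarith [Real.add_one_le_exp (K₃ * r)]
      calc (1 + K₃ * r) ^ t ≤ Real.exp (K₃ * r) ^ t := by gcongr
        _ = Real.exp (K₃ * (r * t)) := by rw [← Real.exp_nat_mul]; ring_nf
        _ ≤ Real.exp (K₃ * R) := by rw [← hR]; gcongr
    have h3 : K₁ * r * t ≤ K₁ * R := by rw [← hR, mul_assoc]; gcongr
    have h4 : 0 ≤ K₁ * r * t := by positivity
    rw [hM]
    have h5 : 0 ≤ S₀ + K₁ * R := by linarith
    gcongr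
  refine ⟨hbound T le_rfl, ?_⟩
  have hsum : ∀ t ≤ T, S t + a * ∑ s ∈ Finset.range t, g s ≤ S₀ + r * t * (K₁ + K₃ * M) := by
    intro t
    induction t with
    | zero => intro _; simpa using hinit
    | succ t ih =>
      intro ht
      have h1 := hstep t ht
      have h2 := ih (Nat.le_of_succ_le ht)
      have h3 := mul_le_mul_of_nonneg_left (hbound t (Nat.le_of_succ_le ht)) (mul_nonneg hK₃ hr)
      rw [Finset.sum_range_succ]
      push_cast
      nlinarith
  have h := hsum T le_rfl
  rw [hR] at h
  linarith [hS0 T]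

namespace Constants

variable (c : Constants)

theorem Lzx_pos : 0 < c.Lzx := by
  have := c.LG1_pos; have := c.LG2_pos; have := c.μG_pos; have := c.Lstar_pos
  unfold Lzx; positivity

theorem Lvx_pos : 0 < c.Lvx := by
  have := c.LG1_pos; have := c.LG2_pos; have := c.μG_pos; have := c.Lstar_pos
  have := c.LF1_pos; have := c.LF2_pos; have := c.LG3_pos; have := c.CF_pos; have := c.Lzx_pos
  unfold Lvx; positivity

theorem Lx_pos : 0 < c.Lx := by
  have : 0 < max c.omega c.LG1 := lt_max_of_lt_left c.omega_pos
  unfold Lx; positivity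

theorem betaVZ_pos : 0 < c.betaVZ := by
  have := c.omega_pos; have := c.μG_pos; unfold betaVZ; positivity

theorem phiZ_pos : 0 < c.phiZ := by
  have := c.Lstar_pos; have := c.μG_pos; unfold phiZ; positivity

theorem phiV_pos : 0 < c.phiV := by
  have := c.Lstar_pos; have := c.μG_pos; have := c.phiZ_pos; have := c.betaVZ_pos
  unfold phiV; exact lt_min (by positivity) (by positivity)

theorem rhoBar_pos : 0 < c.rhoBar := by
  have := c.LG1_pos; have := c.μG_pos; have := c.Bz_pos; have := c.Bv_pos; have := c.betaVZ_pos
  have : 0 < c.Lv := c.Lx_pos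
  have : 0 < c.Lz := c.LG1_pos
  unfold rhoBar
  exact lt_min (lt_min (by positivity) (by positivity)) (lt_min (by positivity) (by positivity))

theorem xi_sq : c.xi ^ 2 = c.μG / 4 *
    min (min (1 / c.Lzx ^ 2) (1 / c.Lvx ^ 2) * (c.Lstar ^ 2 / (c.Bx ^ 2 * c.rhoBar)))
      (min c.phiV c.phiZ * (1 / (2 * c.Lx ^ 2))) ∧ 0 < c.xi := by
  have := c.Lzx_pos; have := c.Lvx_pos; have := c.Lstar_pos; have := c.Bx_pos
  have := c.rhoBar_pos; have := c.Lx_pos; have := c.μG_pos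
  have h1 : 0 < min (1 / c.Lzx ^ 2) (1 / c.Lvx ^ 2) := lt_min (by positivity) (by positivity)
  have h2 : 0 < min c.phiV c.phiZ := lt_min c.phiV_pos c.phiZ_pos
  have h3 : 0 < c.μG / 4 *
      min (min (1 / c.Lzx ^ 2) (1 / c.Lvx ^ 2) * (c.Lstar ^ 2 / (c.Bx ^ 2 * c.rhoBar)))
        (min c.phiV c.phiZ * (1 / (2 * c.Lx ^ 2))) :=
    mul_pos (by positivity) (lt_min (by positivity) (by positivity))
  exact ⟨Real.sq_sqrt h3.le, Real.sqrt_pos.2 h3⟩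

theorem xi_pos : 0 < c.xi := c.xi_sq.2

/-- The second entry of the minimum defining `ξ²` is exactly the upper bound on `ξ` that the drift
requires. -/
theorem xi_sq_mul_Lx_sq_le : c.xi ^ 2 * c.Lx ^ 2 ≤ c.μG / 8 * min c.phiV c.phiZ := by
  have := c.Lx_pos
  have h : c.xi ^ 2 ≤ c.μG / 4 * (min c.phiV c.phiZ * (1 / (2 * c.Lx ^ 2))) := by
    rw [c.xi_sq.1]
    exact mul_le_mul_of_nonneg_left (min_le_right _ _) (by linarith [c.μG_pos])
  calc c.xi ^ 2 * c.Lx ^ 2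
      ≤ c.μG / 4 * (min c.phiV c.phiZ * (1 / (2 * c.Lx ^ 2))) * c.Lx ^ 2 := by gcongr
    _ = _ := by field_simp; ring

theorem phiZ_mul_Lstar_sq : c.phiZ * c.Lstar ^ 2 = c.μG / 64 := by
  have := c.Lstar_pos; have := c.μG_pos
  unfold phiZ; field_simp; norm_num

theorem phiV_mul_Lstar_sq_le : c.phiV * c.Lstar ^ 2 ≤ c.μG / 128 := by
  have := c.Lstar_pos; have := c.μG_pos
  calc c.phiV * c.Lstar ^ 2 ≤ 1 / (8 * (16 * c.Lstar ^ 2 / c.μG)) * c.Lstar ^ 2 := by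
        gcongr; exact min_le_left _ _
    _ = _ := by field_simp; norm_num

theorem phiV_mul_omega_sq_le : c.phiV * c.omega ^ 2 ≤ c.μG ^ 2 * c.phiZ / 16 := by
  have := c.omega_pos; have := c.μG_pos
  calc c.phiV * c.omega ^ 2 ≤ c.μG * c.phiZ / (32 * c.betaVZ) * c.omega ^ 2 := by
        gcongr; exact min_le_right _ _
    _ = _ := by unfold betaVZ; field_simp; ring

/-- The drift of the Lyapunov function, in terms of `a = ‖z - z^*‖`, `b = ‖v - v^*‖`, the norm `D`
of the mean direction in `x`, and `g = ‖∇h‖`; `s` is the inner product of `∇h` with the mean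
direction. -/
theorem drift_le {a b D g s : ℝ} (hs : g ^ 2 + D ^ 2 - c.Lx ^ 2 * (a ^ 2 + b ^ 2) ≤ 2 * s) :
    -c.xi ^ 2 * s + c.phiZ * (-2 * c.μG * a ^ 2 + 2 * c.xi * c.Lstar * (a * D))
      + c.phiV * (-2 * (c.μG * b ^ 2 - c.omega * a * b) + 2 * c.xi * c.Lstar * (b * D))
      ≤ -(c.xi ^ 2 / 2) * g ^ 2 := by
  have hμ := c.μG_pos
  have hp := c.phiZ_pos
  have hq := c.phiV_pos
  -- The decrease of `h` provides `ξ² D² / 2` besides the gradient term; this reserve absorbs the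
  -- motion of `z^*` and `v^*`.
  have h1 : c.xi ^ 2 * s ≥ c.xi ^ 2 / 2 * (g ^ 2 + D ^ 2)
      - c.xi ^ 2 * c.Lx ^ 2 / 2 * (a ^ 2 + b ^ 2) := by
    nlinarith [mul_le_mul_of_nonneg_left hs (sq_nonneg c.xi)]
  have h2 : c.xi ^ 2 * c.Lx ^ 2 ≤ c.μG / 8 * c.phiV :=
    c.xi_sq_mul_Lx_sq_le.trans (mul_le_mul_of_nonneg_left (min_le_left _ _) (by positivity))
  have h3 : c.xi ^ 2 * c.Lx ^ 2 ≤ c.μG / 8 * c.phiZ :=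
    c.xi_sq_mul_Lx_sq_le.trans (mul_le_mul_of_nonneg_left (min_le_right _ _) (by positivity))
  -- Young's inequality spending half of the contraction `2 μ_G φ_z' a²`; `h5` does the same for
  -- `b`.
  have h4 : c.phiZ * (2 * c.xi * c.Lstar * (a * D))
      ≤ c.phiZ * c.μG * a ^ 2 + c.xi ^ 2 * D ^ 2 / 64 := by
    have i1 : 2 * (c.xi * c.Lstar * D) * a ≤ c.μG * a ^ 2 + (c.xi * c.Lstar * D) ^ 2 / c.μG := by
      have : c.μG * a ^ 2 + (c.xi * c.Lstar * D) ^ 2 / c.μG - 2 * (c.xi * c.Lstar * D) * a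
          = (c.μG * a - c.xi * c.Lstar * D) ^ 2 / c.μG := by field_simp; ring
      have : 0 ≤ (c.μG * a - c.xi * c.Lstar * D) ^ 2 / c.μG := by positivity
      linarith
    have i2 : c.phiZ * ((c.xi * c.Lstar * D) ^ 2 / c.μG) = c.xi ^ 2 * D ^ 2 / 64 := by
      have : c.phiZ * ((c.xi * c.Lstar * D) ^ 2 / c.μG)
          = c.phiZ * c.Lstar ^ 2 * (c.xi ^ 2 * D ^ 2) / c.μG := by ring
      rw [this, c.phiZ_mul_Lstar_sq]; field_simp
    nlinarith [mul_le_mul_of_nonneg_left i1 hp.le]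
  have h5 : c.phiV * (2 * c.xi * c.Lstar * (b * D))
      ≤ c.phiV * c.μG * b ^ 2 + c.xi ^ 2 * D ^ 2 / 128 := by
    have i1 : 2 * (c.xi * c.Lstar * D) * b ≤ c.μG * b ^ 2 + (c.xi * c.Lstar * D) ^ 2 / c.μG := by
      have : c.μG * b ^ 2 + (c.xi * c.Lstar * D) ^ 2 / c.μG - 2 * (c.xi * c.Lstar * D) * b
          = (c.μG * b - c.xi * c.Lstar * D) ^ 2 / c.μG := by field_simp; ring
      have : 0 ≤ (c.μG * b - c.xi * c.Lstar * D) ^ 2 / c.μG := by positivity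
      linarith
    have i2 : c.phiV * ((c.xi * c.Lstar * D) ^ 2 / c.μG) ≤ c.xi ^ 2 * D ^ 2 / 128 := by
      have : c.phiV * ((c.xi * c.Lstar * D) ^ 2 / c.μG)
          = c.phiV * c.Lstar ^ 2 * (c.xi ^ 2 * D ^ 2) / c.μG := by ring
      rw [this, div_le_iff₀ hμ]
      nlinarith [mul_le_mul_of_nonneg_right c.phiV_mul_Lstar_sq_le
        (mul_nonneg (sq_nonneg c.xi) (sq_nonneg D))]
    nlinarith [mul_le_mul_of_nonneg_left i1 hq.le]
  -- The error of `z` entering `D_v`: its `a²` part is small because `φ_v'` is chosen small relative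
  -- to `φ_z'`.
  have h6 : c.phiV * (2 * (c.omega * a * b))
      ≤ c.phiV * c.μG / 2 * b ^ 2 + c.μG * c.phiZ / 8 * a ^ 2 := by
    have i1 : 2 * (c.omega * a * b) ≤ c.μG / 2 * b ^ 2 + 2 * (c.omega * a) ^ 2 / c.μG := by
      have : c.μG / 2 * b ^ 2 + 2 * (c.omega * a) ^ 2 / c.μG - 2 * (c.omega * a * b)
          = (c.μG * b - 2 * (c.omega * a)) ^ 2 / (2 * c.μG) := by field_simp; ring
      have : 0 ≤ (c.μG * b - 2 * (c.omega * a)) ^ 2 / (2 * c.μG) := by positivity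
      linarith
    have i2 : c.phiV * (2 * (c.omega * a) ^ 2 / c.μG) ≤ c.μG * c.phiZ / 8 * a ^ 2 := by
      have : c.phiV * (2 * (c.omega * a) ^ 2 / c.μG)
          = 2 * (c.phiV * c.omega ^ 2) * a ^ 2 / c.μG := by ring
      rw [this, div_le_iff₀ hμ]
      nlinarith [mul_le_mul_of_nonneg_right c.phiV_mul_omega_sq_le (sq_nonneg a)]
    nlinarith [mul_le_mul_of_nonneg_left i1 hq.le]
  have h7 := mul_le_mul_of_nonneg_right h2 (sq_nonneg b)
  have h8 := mul_le_mul_of_nonneg_right h3 (sq_nonneg a)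
  have h9 : 0 ≤ c.μG * c.phiZ * a ^ 2 := by positivity
  have h10 : 0 ≤ c.μG * c.phiV * b ^ 2 := by positivity
  have h11 : 0 ≤ c.xi ^ 2 * D ^ 2 := by positivity
  -- What remains is nonpositive: `-2 + 1 + 1/8 + 1/16` times `μ_G φ_z' a²`, `-2 + 1 + 1/2 + 1/16`
  -- times `μ_G φ_v' b²`, and `-1/2 + 1/64 + 1/128` times `ξ² D²`.
  nlinarith

end Constants

end Step

end SOBA

namespace SOBA

/-! ### Expected increment of the Lyapunov function. -/

noncomputable section Convergence

open scoped InnerProductSpace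

namespace Constants

variable (c : Constants)

/-- Weight of `‖z - z^*‖²` in the Lyapunov function. -/
def weightZ : ℝ := c.phiZ / c.xi

/-- Weight of `‖v - v^*‖²` in the Lyapunov function. -/
def weightV : ℝ := c.phiV / c.xi

/-- Constant part of the second order terms of the expected increment of the Lyapunov function. -/
def noise : ℝ :=
  c.lipGradH * c.xi ^ 2 * c.Bx ^ 2
    + c.weightZ * (c.quadZ * c.xi ^ 2 * c.Bx ^ 2 + 2 * c.Bz ^ 2
      + 2 * c.Lstar ^ 2 * c.xi ^ 2 * c.Bx ^ 2)
    + c.weightV * (c.quadV * c.xi ^ 2 * c.Bx ^ 2 + 2 * c.Bv ^ 2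
      + 2 * c.Lstar ^ 2 * c.xi ^ 2 * c.Bx ^ 2)

/-- Coefficient of `‖z - z^*‖²` in the second order terms. -/
def growthZ : ℝ :=
  c.weightZ * (c.quadZ * c.xi ^ 2 * c.Bx ^ 2 + 2 * c.Bz ^ 2 * c.LG1 ^ 2)
    + c.weightV * (4 * c.Bv ^ 2 * c.omega ^ 2)

/-- Coefficient of `‖v - v^*‖²` in the second order terms. -/
def growthV : ℝ :=
  c.weightV * (c.quadV * c.xi ^ 2 * c.Bx ^ 2 + 4 * c.Bv ^ 2 * c.LG1 ^ 2)

/-- Coefficient of the Lyapunov function in the second order terms. -/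
def growth : ℝ := c.growthZ / c.weightZ + c.growthV / c.weightV

theorem weightZ_pos : 0 < c.weightZ := div_pos c.phiZ_pos c.xi_pos

theorem weightV_pos : 0 < c.weightV := div_pos c.phiV_pos c.xi_pos

theorem noise_nonneg : 0 ≤ c.noise := by
  have := c.weightZ_pos; have := c.weightV_pos; have := c.quadZ_pos; have := c.quadV_pos
  have := c.lipGradH_pos
  unfold noise; positivity

theorem growthZ_nonneg : 0 ≤ c.growthZ := by
  have := c.weightZ_pos; have := c.weightV_pos; have := c.quadZ_pos
  unfold growthZ; positivity

theorem growthV_nonneg : 0 ≤ c.growthV := by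
  have := c.weightV_pos; have := c.quadV_pos
  unfold growthV; positivity

theorem growth_nonneg : 0 ≤ c.growth :=
  add_nonneg (div_nonneg c.growthZ_nonneg c.weightZ_pos.le)
    (div_nonneg c.growthV_nonneg c.weightV_pos.le)

theorem growth_mul_ge {H a b : ℝ} (hH : 0 ≤ H) :
    c.growthZ * a ^ 2 + c.growthV * b ^ 2
      ≤ c.growth * (H + c.weightZ * a ^ 2 + c.weightV * b ^ 2) := by
  have hP := c.weightZ_pos
  have hQ := c.weightV_pos
  have h1 : c.growthZ * a ^ 2 = c.growthZ / c.weightZ * (c.weightZ * a ^ 2) := by field_simp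
  have h2 : c.growthV * b ^ 2 = c.growthV / c.weightV * (c.weightV * b ^ 2) := by field_simp
  have h3 : 0 ≤ c.growthZ / c.weightZ := div_nonneg c.growthZ_nonneg hP.le
  have h4 : 0 ≤ c.growthV / c.weightV := div_nonneg c.growthV_nonneg hQ.le
  have h5 : 0 ≤ c.weightZ * a ^ 2 := by positivity
  have h6 : 0 ≤ c.weightV * b ^ 2 := by positivity
  rw [h1, h2, growth, add_mul]
  exact add_le_add (mul_le_mul_of_nonneg_left (by linarith) h3)
    (mul_le_mul_of_nonneg_left (by linarith) h4)

/-- The expected increment of the Lyapunov function, in scalar form. -/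
theorem lyapunov_increment_le {ρ H a b D g s A₁ A₂ B₁ B₂ Mz Mv : ℝ} (hρ : 0 ≤ ρ) (hH : 0 ≤ H)
    (hs : g ^ 2 + D ^ 2 - c.Lx ^ 2 * (a ^ 2 + b ^ 2) ≤ 2 * s)
    (hA₁ : c.μG * a ^ 2 ≤ A₁) (hA₂ : A₂ ≤ c.Lstar * (a * D))
    (hB₁ : c.μG * b ^ 2 - c.omega * a * b ≤ B₁) (hB₂ : B₂ ≤ c.Lstar * (b * D))
    (hMz : Mz ≤ c.Bz ^ 2 * (1 + c.LG1 ^ 2 * a ^ 2))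
    (hMv : Mv ≤ c.Bv ^ 2 * (1 + 2 * (c.LG1 ^ 2 * b ^ 2 + c.omega ^ 2 * a ^ 2))) :
    (H - c.xi * ρ * s + c.lipGradH * (c.xi * ρ) ^ 2 * c.Bx ^ 2)
      + c.weightZ * (a ^ 2 - 2 * ρ * A₁ + 2 * (c.xi * ρ) * A₂
        + c.quadZ * (c.xi * ρ) ^ 2 * c.Bx ^ 2 * (1 + a ^ 2) + 2 * ρ ^ 2 * Mz
        + 2 * c.Lstar ^ 2 * (c.xi * ρ) ^ 2 * c.Bx ^ 2)
      + c.weightV * (b ^ 2 - 2 * ρ * B₁ + 2 * (c.xi * ρ) * B₂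
        + c.quadV * (c.xi * ρ) ^ 2 * c.Bx ^ 2 * (1 + b ^ 2) + 2 * ρ ^ 2 * Mv
        + 2 * c.Lstar ^ 2 * (c.xi * ρ) ^ 2 * c.Bx ^ 2)
    ≤ (1 + c.growth * ρ ^ 2) * (H + c.weightZ * a ^ 2 + c.weightV * b ^ 2) + c.noise * ρ ^ 2
      - c.xi * ρ / 2 * g ^ 2 := by
  have hξ := c.xi_pos
  have hP := c.weightZ_pos
  have hQ := c.weightV_pos
  -- With `γ = ξ ρ` and weights `φ/ξ`, the first order part of the increment is `ρ/ξ` times the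
  -- expression in `drift_le`.
  have hdrift := mul_le_mul_of_nonneg_left (c.drift_le hs) (div_nonneg hρ hξ.le)
  have hPx : c.phiZ = c.xi * c.weightZ := by unfold weightZ; field_simp
  have hQx : c.phiV = c.xi * c.weightV := by unfold weightV; field_simp
  rw [hPx, hQx] at hdrift
  have e1 : ρ / c.xi * (-c.xi ^ 2 * s
      + c.xi * c.weightZ * (-2 * c.μG * a ^ 2 + 2 * c.xi * c.Lstar * (a * D))
      + c.xi * c.weightV * (-2 * (c.μG * b ^ 2 - c.omega * a * b) + 2 * c.xi * c.Lstar * (b * D)))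
      = -(c.xi * ρ * s) + c.weightZ * (-(2 * ρ * (c.μG * a ^ 2))
        + 2 * (c.xi * ρ) * (c.Lstar * (a * D)))
        + c.weightV * (-(2 * ρ * (c.μG * b ^ 2 - c.omega * a * b))
        + 2 * (c.xi * ρ) * (c.Lstar * (b * D))) := by
    field_simp
  have e2 : ρ / c.xi * (-(c.xi ^ 2 / 2) * g ^ 2) = -(c.xi * ρ / 2 * g ^ 2) := by
    field_simp
  rw [e1, e2] at hdrift
  have hgrowth := mul_le_mul_of_nonneg_left (c.growth_mul_ge (a := a) (b := b) hH) (sq_nonneg ρ)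
  have hz : c.weightZ * (a ^ 2 - 2 * ρ * A₁ + 2 * (c.xi * ρ) * A₂
        + c.quadZ * (c.xi * ρ) ^ 2 * c.Bx ^ 2 * (1 + a ^ 2) + 2 * ρ ^ 2 * Mz
        + 2 * c.Lstar ^ 2 * (c.xi * ρ) ^ 2 * c.Bx ^ 2)
      ≤ c.weightZ * (a ^ 2 - 2 * ρ * (c.μG * a ^ 2) + 2 * (c.xi * ρ) * (c.Lstar * (a * D))
        + c.quadZ * (c.xi * ρ) ^ 2 * c.Bx ^ 2 * (1 + a ^ 2)
        + 2 * ρ ^ 2 * (c.Bz ^ 2 * (1 + c.LG1 ^ 2 * a ^ 2))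
        + 2 * c.Lstar ^ 2 * (c.xi * ρ) ^ 2 * c.Bx ^ 2) := by gcongr
  have hv : c.weightV * (b ^ 2 - 2 * ρ * B₁ + 2 * (c.xi * ρ) * B₂
        + c.quadV * (c.xi * ρ) ^ 2 * c.Bx ^ 2 * (1 + b ^ 2) + 2 * ρ ^ 2 * Mv
        + 2 * c.Lstar ^ 2 * (c.xi * ρ) ^ 2 * c.Bx ^ 2)
      ≤ c.weightV * (b ^ 2 - 2 * ρ * (c.μG * b ^ 2 - c.omega * a * b)
        + 2 * (c.xi * ρ) * (c.Lstar * (b * D))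
        + c.quadV * (c.xi * ρ) ^ 2 * c.Bx ^ 2 * (1 + b ^ 2)
        + 2 * ρ ^ 2 * (c.Bv ^ 2 * (1 + 2 * (c.LG1 ^ 2 * b ^ 2 + c.omega ^ 2 * a ^ 2)))
        + 2 * c.Lstar ^ 2 * (c.xi * ρ) ^ 2 * c.Bx ^ 2) := by gcongr
  rw [growthZ, growthV] at hgrowth
  rw [noise]
  linarith

/-- The constant in the rate of convergence. -/
def rate (Δ : ℝ) : ℝ :=
  let S₀ := (1 + c.weightZ + c.weightV) * Δ
  let M := (S₀ + c.noise * c.rhoBar ^ 2) * Real.exp (c.growth * c.rhoBar ^ 2)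
  2 / (c.xi * c.rhoBar) * (S₀ + c.rhoBar ^ 2 * (c.noise + c.growth * M)) + 4 * c.lipGradH * M

end Constants

variable {p d n m : ℕ} {c : Constants}

/-- The Lyapunov function at `y = (z, v, x)`. -/
def lyapunov (c : Constants) (F G : E p → E d → ℝ) (y : E p × E p × E d) : ℝ :=
  (value F G y.2.2 - ⨅ x, value F G x) + c.weightZ * ‖y.1 - zStar G y.2.2‖ ^ 2
    + c.weightV * ‖y.2.1 - vStar F G y.2.2‖ ^ 2

variable {F : Fin m → E p → E d → ℝ} {G : Fin n → E p → E d → ℝ} {Ω : Type*} [MeasurableSpace Ω]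
  {P : Measure Ω} [IsProbabilityMeasure P] {I : ℕ → Ω → Fin n} {J : ℕ → Ω → Fin m} {t : ℕ}
  {Y : Ω → E p × E p × E d}

/-- Descent lemma for `h` in expectation, the stochastic direction averaging to `D_x`. -/
theorem Regular.integral_value_step_le (hR : Regular c F G) (hS : UniformSampling P I J)
    (hY : Predictable I J t Y) (hn : n ≠ 0) (hm : m ≠ 0) (γ : ℝ)
    (hB : P[fun ω => ‖dirX (F (J t ω)) (G (I t ω)) (Y ω)‖ ^ 2 |
      MeasurableSpace.comap Y inferInstance] ≤ᵐ[P] fun _ => c.Bx ^ 2) :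
    ∫ ω, value (mean F) (mean G) ((Y ω).2.2 - γ • dirX (F (J t ω)) (G (I t ω)) (Y ω)) ∂P
      ≤ ∫ ω, (value (mean F) (mean G) (Y ω).2.2
        - γ * ⟪gradient (value (mean F) (mean G)) (Y ω).2.2, dirX (mean F) (mean G) (Y ω)⟫_ℝ
        + c.lipGradH * γ ^ 2 * c.Bx ^ 2) ∂P := by
  set h := value (mean F) (mean G) with hh
  have m2 := integral_mul_le_of_condExp_le (hY.measurable hS) (w := fun _ => (1 : ℝ))
    (hY.integrable_draw hS fun y i j => ‖dirX (F j) (G i) y‖ ^ 2) measurable_const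
    (fun _ => zero_le_one) (hY.integrable_draw hS fun y i j => 1 * ‖dirX (F j) (G i) y‖ ^ 2)
    (hY.integrable hS fun _ => 1 * c.Bx ^ 2) hB
  simp only [one_mul] at m2
  have i1 := hY.integral_inner_draw hS (fun y => gradient h y.2.2) (hR.dirX_mean hn hm)
  have f0 := hY.integrable hS fun y => h y.2.2
  have f1 := (hY.integrable_draw hS
    fun y i j => ⟪gradient h y.2.2, dirX (F j) (G i) y⟫_ℝ).const_mul γ
  have f2 := (hY.integrable_draw hS
    fun y i j => ‖dirX (F j) (G i) y‖ ^ 2).const_mul (c.lipGradH * γ ^ 2)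
  have e1 := (hY.integrable hS
    fun y => ⟪gradient h y.2.2, dirX (mean F) (mean G) y⟫_ℝ).const_mul γ
  have e2 : Integrable (fun _ : Ω => c.lipGradH * γ ^ 2 * c.Bx ^ 2) P := integrable_const _
  refine (integral_mono (hY.integrable_draw hS
    fun y i j => h (y.2.2 - γ • dirX (F j) (G i) y)) ((f0.sub f1).add f2) fun ω => ?_).trans ?_
  · set e := dirX (F (J t ω)) (G (I t ω)) (Y ω)
    have h1 := le_of_abs_le (hR.regularPair.value_expansion (Y ω).2.2 ((Y ω).2.2 - γ • e))
    have h2 : (Y ω).2.2 - γ • e - (Y ω).2.2 = -(γ • e) := by abel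
    rw [h2, inner_neg_right, real_inner_smul_right, norm_neg, norm_smul, mul_pow,
      Real.norm_eq_abs, sq_abs] at h1
    change h ((Y ω).2.2 - γ • e) ≤ h (Y ω).2.2 - γ * ⟪gradient h (Y ω).2.2, e⟫_ℝ
      + c.lipGradH * γ ^ 2 * ‖e‖ ^ 2
    linarith
  · rw [integral_add' (f0.sub f1) f2, integral_sub' f0 f1]
    have hrhs := integral_add' (f0.sub e1) e2
    rw [integral_sub' f0 e1] at hrhs
    refine le_trans ?_ (le_of_eq hrhs.symm)
    simp only [integral_const_mul, integral_const, probReal_univ, one_smul] at m2 ⊢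
    rw [i1]
    have := mul_le_mul_of_nonneg_left m2
      (mul_nonneg c.lipGradH_pos.le (sq_nonneg γ))
    linarith

theorem Regular.lyapunov_step_le (hR : Regular c F G)
    (hb : BddBelow (Set.range (value (mean F) (mean G)))) (hS : UniformSampling P I J)
    (hY : Predictable I J t Y) (hn : n ≠ 0) (hm : m ≠ 0) {ρ : ℝ} (hρ : 0 ≤ ρ)
    (hz : P[fun ω => ‖dirZ (G (I t ω)) (Y ω)‖ ^ 2 | MeasurableSpace.comap Y inferInstance]
      ≤ᵐ[P] fun ω => c.Bz ^ 2 * (1 + ‖dirZ (mean G) (Y ω)‖ ^ 2))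
    (hv : P[fun ω => ‖dirV (F (J t ω)) (G (I t ω)) (Y ω)‖ ^ 2 |
        MeasurableSpace.comap Y inferInstance]
      ≤ᵐ[P] fun ω => c.Bv ^ 2 * (1 + ‖dirV (mean F) (mean G) (Y ω)‖ ^ 2))
    (hx : P[fun ω => ‖dirX (F (J t ω)) (G (I t ω)) (Y ω)‖ ^ 2 |
        MeasurableSpace.comap Y inferInstance] ≤ᵐ[P] fun _ => c.Bx ^ 2) :
    ∫ ω, lyapunov c (mean F) (mean G) ((Y ω).1 - ρ • dirZ (G (I t ω)) (Y ω),
        (Y ω).2.1 - ρ • dirV (F (J t ω)) (G (I t ω)) (Y ω),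
        (Y ω).2.2 - (c.xi * ρ) • dirX (F (J t ω)) (G (I t ω)) (Y ω)) ∂P
      + c.xi * ρ / 2 * ∫ ω, ‖gradient (value (mean F) (mean G)) (Y ω).2.2‖ ^ 2 ∂P
      ≤ (1 + c.growth * ρ ^ 2) * ∫ ω, lyapunov c (mean F) (mean G) (Y ω) ∂P
        + c.noise * ρ ^ 2 := by
  have hRP := hR.regularPair
  set Fm := mean F with hFm
  set Gm := mean G with hGm
  set h := value Fm Gm with hh
  have sz := hY.integral_tracking_le hS (ρ := ρ) (γ := c.xi * ρ)
    hRP.quadraticallyApproximable_zStar c.quadZ_pos.le (w := fun y => y.1) continuous_fst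
    (Dw := fun y i _ => dirZ (G i) y) (hR.dirZ_mean hm) (Dx := fun y i j => dirX (F j) (G i) y)
    (hR.dirX_mean hn hm) (M := fun y => c.Bz ^ 2 * (1 + ‖dirZ Gm y‖ ^ 2)) hz hx
  have sv := hY.integral_tracking_le hS (ρ := ρ) (γ := c.xi * ρ)
    hRP.quadraticallyApproximable_vStar c.quadV_pos.le (w := fun y => y.2.1) continuous_snd.fst
    (Dw := fun y i j => dirV (F j) (G i) y) (hR.dirV_mean hn hm)
    (Dx := fun y i j => dirX (F j) (G i) y) (hR.dirX_mean hn hm)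
    (M := fun y => c.Bv ^ 2 * (1 + ‖dirV Fm Gm y‖ ^ 2)) hv hx
  have sx := hR.integral_value_step_le hS hY hn hm (c.xi * ρ) hx
  rw [← hFm, ← hGm, ← hh] at sx
  set Z : E p × E p × E d → ℝ := fun y => ‖y.1 - zStar Gm y.2.2‖ ^ 2
    - 2 * ρ * ⟪y.1 - zStar Gm y.2.2, dirZ Gm y⟫_ℝ
    + 2 * (c.xi * ρ) * ⟪y.1 - zStar Gm y.2.2, fderiv ℝ (zStar Gm) y.2.2 (dirX Fm Gm y)⟫_ℝ
    + c.quadZ * (c.xi * ρ) ^ 2 * c.Bx ^ 2 * (1 + ‖y.1 - zStar Gm y.2.2‖ ^ 2)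
    + 2 * ρ ^ 2 * (c.Bz ^ 2 * (1 + ‖dirZ Gm y‖ ^ 2))
    + 2 * c.Lstar ^ 2 * (c.xi * ρ) ^ 2 * c.Bx ^ 2 with hZ
  set V : E p × E p × E d → ℝ := fun y => ‖y.2.1 - vStar Fm Gm y.2.2‖ ^ 2
    - 2 * ρ * ⟪y.2.1 - vStar Fm Gm y.2.2, dirV Fm Gm y⟫_ℝ
    + 2 * (c.xi * ρ) * ⟪y.2.1 - vStar Fm Gm y.2.2, fderiv ℝ (vStar Fm Gm) y.2.2 (dirX Fm Gm y)⟫_ℝ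
    + c.quadV * (c.xi * ρ) ^ 2 * c.Bx ^ 2 * (1 + ‖y.2.1 - vStar Fm Gm y.2.2‖ ^ 2)
    + 2 * ρ ^ 2 * (c.Bv ^ 2 * (1 + ‖dirV Fm Gm y‖ ^ 2))
    + 2 * c.Lstar ^ 2 * (c.xi * ρ) ^ 2 * c.Bx ^ 2 with hV
  set X : E p × E p × E d → ℝ := fun y => h y.2.2
    - c.xi * ρ * ⟪gradient h y.2.2, dirX Fm Gm y⟫_ℝ
    + c.lipGradH * (c.xi * ρ) ^ 2 * c.Bx ^ 2 with hX
  change _ ≤ ∫ ω, Z (Y ω) ∂P at sz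
  change _ ≤ ∫ ω, V (Y ω) ∂P at sv
  change _ ≤ ∫ ω, X (Y ω) ∂P at sx
  -- Once the current draw has been averaged out, the remaining inequality is deterministic and
  -- holds at every point.
  have hmono : ∀ y, X y - (⨅ x, h x) + c.weightZ * Z y + c.weightV * V y
      ≤ (1 + c.growth * ρ ^ 2) * lyapunov c Fm Gm y + c.noise * ρ ^ 2
        - c.xi * ρ / 2 * ‖gradient h y.2.2‖ ^ 2 := by
    rintro ⟨z, v, x⟩
    have hH : 0 ≤ h x - ⨅ x, h x := sub_nonneg.2 (ciInf_le hb x)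
    -- Polarization: twice the inner product is the sum of the squares minus the squared difference,
    -- which the tracking errors control.
    have hs : ‖gradient h x‖ ^ 2 + ‖dirX Fm Gm (z, v, x)‖ ^ 2
        - c.Lx ^ 2 * (‖z - zStar Gm x‖ ^ 2 + ‖v - vStar Fm Gm x‖ ^ 2)
        ≤ 2 * ⟪gradient h x, dirX Fm Gm (z, v, x)⟫_ℝ := by
      have h1 := hRP.norm_dirX_sub_gradient_sq_le z v x
      rw [norm_sub_sq_real, real_inner_comm] at h1
      linarith
    have hinner : ∀ {L K : ℝ} {ζ : E d → E p}, QuadraticallyApproximable ζ L K → 0 ≤ L →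
        ∀ u : E p, ⟪u, fderiv ℝ ζ x (dirX Fm Gm (z, v, x))⟫_ℝ
          ≤ L * (‖u‖ * ‖dirX Fm Gm (z, v, x)‖) := by
      intro L K ζ hζ hL u
      refine (real_inner_le_norm _ _).trans ?_
      have := mul_le_mul_of_nonneg_left
        (ContinuousLinearMap.le_of_opNorm_le _ (hζ.norm_fderiv_le hL x) (dirX Fm Gm (z, v, x)))
        (norm_nonneg u)
      linarith
    have hMz : c.Bz ^ 2 * (1 + ‖dirZ Gm (z, v, x)‖ ^ 2)
        ≤ c.Bz ^ 2 * (1 + c.LG1 ^ 2 * ‖z - zStar Gm x‖ ^ 2) := by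
      rw [← mul_pow]
      have := hRP.norm_dirZ_le z v x
      gcongr
    have hMv : c.Bv ^ 2 * (1 + ‖dirV Fm Gm (z, v, x)‖ ^ 2)
        ≤ c.Bv ^ 2 * (1 + 2 * (c.LG1 ^ 2 * ‖v - vStar Fm Gm x‖ ^ 2
          + c.omega ^ 2 * ‖z - zStar Gm x‖ ^ 2)) := by
      rw [← mul_pow, ← mul_pow]
      have h1 := hRP.norm_dirV_le z v x
      have h2 : ‖dirV Fm Gm (z, v, x)‖ ^ 2
          ≤ (c.LG1 * ‖v - vStar Fm Gm x‖ + c.omega * ‖z - zStar Gm x‖) ^ 2 := by gcongr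
      have h3 := sq_nonneg (c.LG1 * ‖v - vStar Fm Gm x‖ - c.omega * ‖z - zStar Gm x‖)
      refine mul_le_mul_of_nonneg_left ?_ (sq_nonneg _)
      linarith
    have key := c.lyapunov_increment_le hρ hH hs (hRP.inner_dirZ_ge z v x)
      (hinner hRP.quadraticallyApproximable_zStar c.Lstar_pos.le (z - zStar Gm x))
      (hRP.inner_dirV_ge z v x)
      (hinner hRP.quadraticallyApproximable_vStar c.Lstar_pos.le (v - vStar Fm Gm x)) hMz hMv
    simp only [hX, hZ, hV, lyapunov]
    rw [← hh]
    linarith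
  have iX := hY.integrable hS X
  have iZ := (hY.integrable hS Z).const_mul c.weightZ
  have iV := (hY.integrable hS V).const_mul c.weightV
  have iL := (hY.integrable hS (lyapunov c Fm Gm)).const_mul (1 + c.growth * ρ ^ 2)
  have iG := (hY.integrable hS fun y => ‖gradient h y.2.2‖ ^ 2).const_mul (c.xi * ρ / 2)
  have i1 : Integrable (fun _ : Ω => ⨅ x, h x) P := integrable_const _
  have i2 : Integrable (fun _ : Ω => c.noise * ρ ^ 2) P := integrable_const _
  have main := integral_mono (((iX.sub i1).add iZ).add iV) ((iL.add i2).sub iG)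
    fun ω => hmono (Y ω)
  rw [integral_add' ((iX.sub i1).add iZ) iV, integral_add' (iX.sub i1) iZ, integral_sub' iX i1,
    integral_sub' (iL.add i2) iG, integral_add' iL i2] at main
  simp only [integral_const_mul, integral_const, probReal_univ, one_smul] at main
  have jX := hY.integrable_draw hS fun y i j => h (y.2.2 - (c.xi * ρ) • dirX (F j) (G i) y)
  have jZ := (hY.integrable_draw hS fun y i j => ‖y.1 - ρ • dirZ (G i) y
    - zStar Gm (y.2.2 - (c.xi * ρ) • dirX (F j) (G i) y)‖ ^ 2).const_mul c.weightZ
  have jV := (hY.integrable_draw hS fun y i j => ‖y.2.1 - ρ • dirV (F j) (G i) y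
    - vStar Fm Gm (y.2.2 - (c.xi * ρ) • dirX (F j) (G i) y)‖ ^ 2).const_mul c.weightV
  have hlhs := integral_add' ((jX.sub i1).add jZ) jV
  rw [integral_add' (jX.sub i1) jZ, integral_sub' jX i1] at hlhs
  simp only [integral_const_mul, integral_const, probReal_univ, one_smul] at hlhs
  have hz' := mul_le_mul_of_nonneg_left sz c.weightZ_pos.le
  have hv' := mul_le_mul_of_nonneg_left sv c.weightV_pos.le
  have hlhs' : ∫ ω, lyapunov c Fm Gm ((Y ω).1 - ρ • dirZ (G (I t ω)) (Y ω),
        (Y ω).2.1 - ρ • dirV (F (J t ω)) (G (I t ω)) (Y ω),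
        (Y ω).2.2 - (c.xi * ρ) • dirX (F (J t ω)) (G (I t ω)) (Y ω)) ∂P = _ := hlhs
  rw [hlhs']
  linarith

end Convergence

end SOBA

/-! ### The convergence rate. -/

theorem mainTheorem3 (c : SOBA.Constants) (Δ : ℝ) :
    ∃ C : ℝ, ∀ (n m p d : ℕ) (F : Fin m → SOBA.E p → SOBA.E d → ℝ)
      (G : Fin n → SOBA.E p → SOBA.E d → ℝ) (h : SOBA.E d → ℝ),
      h = SOBA.value (SOBA.mean F) (SOBA.mean G) →
      SOBA.Regular c F G →
      BddBelow (Set.range h) →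
      ∀ (z₀ v₀ : SOBA.E p) (x₀ : SOBA.E d),
      (h x₀ - ⨅ x, h x) + ‖z₀ - SOBA.zStar (SOBA.mean G) x₀‖ ^ 2
        + ‖v₀ - SOBA.vStar (SOBA.mean F) (SOBA.mean G) x₀‖ ^ 2 ≤ Δ →
      ∀ (Ω : Type*) [MeasurableSpace Ω] (P : MeasureTheory.Measure Ω)
        [MeasureTheory.IsProbabilityMeasure P] (I : ℕ → Ω → Fin n) (J : ℕ → Ω → Fin m),
      SOBA.UniformSampling P I J →
      ∀ (T : ℕ) (ρ γ : ℝ) (Y : ℕ → Ω → SOBA.E p × SOBA.E p × SOBA.E d),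
      1 < T →
      ρ = c.rhoBar / √(T : ℝ) →
      γ = c.xi * ρ →
      (Y = fun t ω =>
        SOBA.iter F G ρ γ (z₀, v₀, x₀) (fun s => I s ω) (fun s => J s ω) t) →
      SOBA.BoundedMoments c P F G I J Y T →
      Differentiable ℝ h ∧
      (∀ t, MeasureTheory.Integrable (fun ω => ‖gradient h (Y t ω).2.2‖ ^ 2) P) ∧
      (1 / (T : ℝ)) * ∑ t ∈ Finset.Icc 1 T, ∫ ω, ‖gradient h (Y t ω).2.2‖ ^ 2 ∂P
        ≤ C * (T : ℝ) ^ (-(1 / 2) : ℝ) := by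
  refine ⟨c.rate Δ, ?_⟩
  intro n m p d F G h hh hR hb z₀ v₀ x₀ hΔ Ω _ P _ I J hS T ρ γ Y hT hρ hγ hYdef hBM
  subst hh
  have hRP := hR.regularPair
  -- A probability space is nonempty, and one outcome yields an index in `Fin n` and in `Fin m`, so
  -- both means are genuine.
  have : Nonempty Ω := by
    by_contra hne
    rw [not_nonempty_iff] at hne
    exact IsProbabilityMeasure.ne_zero P (Measure.eq_zero_of_isEmpty P)
  have hn : n ≠ 0 := by
    rintro rfl
    exact (I 0 (Classical.arbitrary Ω)).elim0
  have hm : m ≠ 0 := by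
    rintro rfl
    exact (J 0 (Classical.arbitrary Ω)).elim0
  have hY (t : ℕ) : SOBA.Predictable I J t (Y t) := by
    obtain ⟨Φ, hΦ⟩ := SOBA.exists_iter_eq_path F G ρ γ (z₀, v₀, x₀) I J t
    exact ⟨Φ, fun ω => by rw [hYdef]; exact hΦ ω⟩
  have hTpos : (0 : ℝ) < T := by exact_mod_cast zero_lt_one.trans hT
  have hsq : √(T : ℝ) ^ 2 = T := Real.sq_sqrt hTpos.le
  have hsqrt : 0 < √(T : ℝ) := Real.sqrt_pos.2 hTpos
  have hξ := c.xi_pos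
  have hρb := c.rhoBar_pos
  have hρ0 : 0 < ρ := by rw [hρ]; positivity
  set S : ℕ → ℝ := fun t => ∫ ω, SOBA.lyapunov c (SOBA.mean F) (SOBA.mean G) (Y t ω) ∂P with hSdef
  set g : ℕ → ℝ := fun t =>
    ∫ ω, ‖gradient (SOBA.value (SOBA.mean F) (SOBA.mean G)) (Y t ω).2.2‖ ^ 2 ∂P with hgdef
  have hgap (x : SOBA.E d) : 0 ≤ SOBA.value (SOBA.mean F) (SOBA.mean G) x
      - ⨅ x, SOBA.value (SOBA.mean F) (SOBA.mean G) x := sub_nonneg.2 (ciInf_le hb x)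
  have hP := c.weightZ_pos
  have hQ := c.weightV_pos
  have hS0 (t : ℕ) : 0 ≤ S t := integral_nonneg fun ω =>
    add_nonneg (add_nonneg (hgap _) (by positivity)) (by positivity)
  have hg0 (t : ℕ) : 0 ≤ g t := integral_nonneg fun ω => by positivity
  have hinit : S 0 ≤ (1 + c.weightZ + c.weightV) * Δ := by
    have h0 : S 0 = SOBA.lyapunov c (SOBA.mean F) (SOBA.mean G) (z₀, v₀, x₀) := by
      simp only [hSdef, hYdef, SOBA.iter, integral_const, probReal_univ, one_smul]
    rw [h0]
    have h1 := hgap x₀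
    have h2 := sq_nonneg ‖z₀ - SOBA.zStar (SOBA.mean G) x₀‖
    have h3 := sq_nonneg ‖v₀ - SOBA.vStar (SOBA.mean F) (SOBA.mean G) x₀‖
    have h4 := mul_le_mul_of_nonneg_left hΔ
      (show 0 ≤ 1 + c.weightZ + c.weightV by positivity)
    refine le_trans ?_ h4
    simp only [SOBA.lyapunov]
    nlinarith [mul_nonneg hP.le h1, mul_nonneg hP.le h3, mul_nonneg hQ.le h1, mul_nonneg hQ.le h2]
  have hstep : ∀ t < T, S (t + 1) + c.xi * ρ / 2 * g t
      ≤ (1 + c.growth * ρ ^ 2) * S t + c.noise * ρ ^ 2 := by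
    intro t ht
    have h1 := hR.lyapunov_step_le hb hS (hY t) hn hm hρ0.le (hBM.bound_z t ht) (hBM.bound_v t ht)
      (hBM.bound_x t ht)
    have h2 (ω : Ω) : Y (t + 1) ω = ((Y t ω).1 - ρ • SOBA.dirZ (G (I t ω)) (Y t ω),
        (Y t ω).2.1 - ρ • SOBA.dirV (F (J t ω)) (G (I t ω)) (Y t ω),
        (Y t ω).2.2 - (c.xi * ρ) • SOBA.dirX (F (J t ω)) (G (I t ω)) (Y t ω)) := by
      rw [hYdef, ← hγ]; rfl
    simp only [hSdef, h2]
    exact h1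
  -- This makes the accumulated second order terms independent of `T`.
  have hρT : ρ ^ 2 * T = c.rhoBar ^ 2 := by
    rw [hρ, div_pow, hsq]; field_simp
  obtain ⟨hM, hsum⟩ := SOBA.gronwall_sum_le hS0 hg0 (show 0 ≤ c.xi * ρ / 2 by positivity)
    (sq_nonneg ρ) c.noise_nonneg c.growth_nonneg hρT hinit hstep
  refine ⟨hRP.differentiable_value, fun t => (hY t).integrable hS
    fun y => ‖gradient (SOBA.value (SOBA.mean F) (SOBA.mean G)) y.2.2‖ ^ 2, ?_⟩
  -- The step inequality covers `t = 0, …, T - 1`, while the theorem sums over `1, …, T`; the last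
  -- term is bounded through the gap `h - inf h`.
  have hlast : g T ≤ 4 * c.lipGradH * S T := by
    rw [hSdef, ← integral_const_mul]
    refine integral_mono ((hY T).integrable hS
      fun y => ‖gradient (SOBA.value (SOBA.mean F) (SOBA.mean G)) y.2.2‖ ^ 2)
      (((hY T).integrable hS (SOBA.lyapunov c (SOBA.mean F) (SOBA.mean G))).const_mul _)
      fun ω => ?_
    refine (hRP.norm_gradient_value_sq_le hb _).trans ?_
    refine mul_le_mul_of_nonneg_left ?_ (by linarith [c.lipGradH_pos])
    have h1 : 0 ≤ c.weightZ * ‖(Y T ω).1 - SOBA.zStar (SOBA.mean G) (Y T ω).2.2‖ ^ 2 := by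
      positivity
    have h2 : 0 ≤ c.weightV *
        ‖(Y T ω).2.1 - SOBA.vStar (SOBA.mean F) (SOBA.mean G) (Y T ω).2.2‖ ^ 2 := by positivity
    simp only [SOBA.lyapunov]
    linarith
  have hIcc : ∑ t ∈ Finset.Icc 1 T, g t ≤ ∑ t ∈ Finset.range T, g t + g T := by
    rw [← Finset.sum_range_succ]
    refine Finset.sum_le_sum_of_subset_of_nonneg (fun t ht => ?_) fun t _ _ => hg0 t
    rw [Finset.mem_Icc] at ht
    exact Finset.mem_range.2 (Nat.lt_succ_of_le ht.2)
  have hpow : (T : ℝ) ^ (-(1 / 2) : ℝ) = 1 / √(T : ℝ) := by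
    rw [Real.rpow_neg hTpos.le, Real.sqrt_eq_rpow, inv_eq_one_div]
  rw [hpow]
  set S₀ := (1 + c.weightZ + c.weightV) * Δ with hS₀
  set M := (S₀ + c.noise * c.rhoBar ^ 2) * Real.exp (c.growth * c.rhoBar ^ 2) with hMdef
  have hrate : c.rate Δ = 2 / (c.xi * c.rhoBar)
      * (S₀ + c.rhoBar ^ 2 * (c.noise + c.growth * M)) + 4 * c.lipGradH * M := rfl
  have hM0 : 0 ≤ M := (hS0 T).trans hM
  have hL := c.lipGradH_pos
  have h1 : ∑ t ∈ Finset.range T, g t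
      ≤ 2 * √(T : ℝ) / (c.xi * c.rhoBar) * (S₀ + c.rhoBar ^ 2 * (c.noise + c.growth * M)) := by
    -- The factor `√T` arises here; the final division by `T` leaves `1/√T`.
    have h2 : c.xi * ρ / 2 = (2 * √(T : ℝ) / (c.xi * c.rhoBar))⁻¹ := by
      rw [hρ]; field_simp
    rw [h2] at hsum
    exact (inv_mul_le_iff₀ (by positivity)).1 hsum
  have h3 : g T ≤ √(T : ℝ) * (4 * c.lipGradH * M) := by
    have h4 : 1 ≤ √(T : ℝ) := Real.one_le_sqrt.2 (by exact_mod_cast hT.le)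
    have h5 : g T ≤ 4 * c.lipGradH * M :=
      hlast.trans (mul_le_mul_of_nonneg_left hM (by positivity))
    exact h5.trans (le_mul_of_one_le_left (by positivity) h4)
  have h6 : ∑ t ∈ Finset.Icc 1 T, g t ≤ √(T : ℝ) * c.rate Δ := by
    rw [hrate]
    refine hIcc.trans ((add_le_add h1 h3).trans (le_of_eq ?_))
    ring
  calc (1 / (T : ℝ)) * ∑ t ∈ Finset.Icc 1 T, g t
      ≤ (1 / (T : ℝ)) * (√(T : ℝ) * c.rate Δ) := by gcongr
    _ = c.rate Δ * (1 / √(T : ℝ)) := by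
      nth_rewrite 1 [← hsq]
      field_simp
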